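/- Setup. Lattice paths start at $(0,0)$ and use steps $E=(1,0)$ and $N=(0,1)$; the steps of a path are numbered from $1$. A path has an $NE$ corner at $h$ if its step $h$ is $N$ and its step $h+1$ is $E$; an $EN$ corner at $h$ is defined by interchanging $E$ and $N$. Let $P$ and $Q$ be lattice paths from $(0,0)$ to $(m,r)$ with $P$ never going above $Q$. For $1\le i\le r$, let $N_i$ be the set of all $j$ such that step $j$ is the $i$-th North step of some lattice path from $(0,0)$ to $(m,r)$ that goes neither above $Q$ nor below $P$. The lattice path matroid $M[P,Q]$ is the transversal matroid on $\{1,\dots,m+r\}$ presented by $(N_1,\dots,N_r)$, that is, its independent sets are the partial transversals of this family. For an element $j$, let $n(j)=\{i : j\in N_i\}$. For a positive integer $k$, a $k$-separation of a matroid $M$ with rank function $\rho$ is a partition of the ground set into two sets $X,Y$, each with at least $k$ elements, such that $\rho(X)+\rho(Y)\le \rho(M)+k-1$; it is exact if equality holds. The (Tutte) connectivity $\lambda(M)$ is the least positive integer $k$ such that $M$ has a $k$-separation, and $\infty$ if there is none. A fundamental flat of a connected matroid $M$ is a flat $X$ with $M|X$ connected, $|X|>1$ and $\rho(X)<\rho(M)$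 such that, for some spanning circuit $C$ of $M$, the set $X\cap C$ is a basis of $X$. Theorem. Let $M=M[P,Q]$ be a connected lattice path matroid of rank $r$ and nullity $m$ that is not uniform. Then the minimum $$k_M:=\min\{|n(j)| : P \text{ has an } NE \text{ corner at } j \text{ or } Q \text{ has an } EN \text{ corner at } j-1\}$$ exists (that is, the set is non-empty), and $\lambda(M)=k_M$. Furthermore, there is a fundamental flat $F$ of $M$ such that $F$ and its complement form an exact $k_M$-separation of $M$. -/

import Mathlib

namespace LPM

/-! ### General matroid notions -/

/-- `I` is a partial transversal of the family `A`: the elements of `I` can be matched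
injectively with members of the family that contain them. -/
def IsPartialTransversal {α ι : Type*} (A : ι → Set α) (I : Set α) : Prop :=
  ∃ f : I → ι, Function.Injective f ∧ ∀ x : I, (x : α) ∈ A (f x)

theorem IsPartialTransversal.of_injOn {α ι : Type*} {A : ι → Set α} {I : Set α} (f : α → ι)
    (hf : Set.InjOn f I) (hA : ∀ x ∈ I, x ∈ A (f x)) : IsPartialTransversal A I :=
  ⟨fun x => f x, fun x y h => Subtype.ext (hf x.2 y.2 h), fun x => hA x x.2⟩

theorem IsPartialTransversal.exists_injOn {α ι : Type*} [Nonempty ι] {A : ι → Set α} {I : Set α}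
    (h : IsPartialTransversal A I) :
    ∃ f : α → ι, Set.InjOn f I ∧ ∀ x ∈ I, x ∈ A (f x) := by
  classical
  obtain ⟨f, hf, hA⟩ := h
  refine ⟨fun x => if hx : x ∈ I then f ⟨x, hx⟩ else Classical.arbitrary ι, ?_, ?_⟩
  · intro x hx y hy hxy
    simp only [hx, hy, dif_pos] at hxy
    exact congrArg Subtype.val (hf hxy)
  · intro x hx
    simpa only [hx, dif_pos] using hA ⟨x, hx⟩

theorem IsPartialTransversal.subset {α ι : Type*} {A : ι → Set α} {I J : Set α}
    (hJ : IsPartialTransversal A J) (h : I ⊆ J) : IsPartialTransversal A I := by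
  obtain ⟨f, hf, hA⟩ := hJ
  refine ⟨fun x => f ⟨x, h x.2⟩, fun x y hxy => ?_, fun x => hA ⟨x, h x.2⟩⟩
  exact Subtype.ext (by simpa using hf hxy)

theorem IsPartialTransversal.augment {α ι : Type*} {A : ι → Set α} {I J : Set α}
    (hIfin : I.Finite) (hJfin : J.Finite)
    (hI : IsPartialTransversal A I) (hJ : IsPartialTransversal A J) (hlt : I.ncard < J.ncard) :
    ∃ e ∈ J, e ∉ I ∧ IsPartialTransversal A (insert e I) := by
  classical
  have hJne : J.Nonempty := by
    rw [Set.nonempty_iff_ne_empty]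
    rintro rfl
    simp at hlt
  obtain ⟨g₀, -⟩ := id hJ
  have : Nonempty ι := ⟨g₀ ⟨_, hJne.some_mem⟩⟩
  obtain ⟨f, hf, hfA⟩ := hI.exists_injOn
  obtain ⟨g, hg, hgA⟩ := hJ.exists_injOn
  suffices H : ∀ (n : ℕ) (f : α → ι), Set.InjOn f I → (∀ x ∈ I, x ∈ A (f x)) →
      {x ∈ J | f x ≠ g x}.ncard = n →
      ∃ e ∈ J, e ∉ I ∧ IsPartialTransversal A (insert e I) from H _ f hf hfA rfl
  intro n
  induction n using Nat.strong_induction_on with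
  | _ n ih =>
    intro f hf hfA hn
    have hex : ∃ y ∈ J, g y ∉ f '' I := by
      by_contra! hcon
      have hsub : g '' J ⊆ f '' I := by
        rintro _ ⟨y, hy, rfl⟩
        exact hcon y hy
      have h1 := Set.ncard_le_ncard hsub (hIfin.image f)
      rw [hg.ncard_image, hf.ncard_image] at h1
      omega
    obtain ⟨y, hyJ, hy⟩ := hex
    have hinj : Set.InjOn (Function.update f y (g y)) (insert y I) := by
      intro a ha b hb hab
      by_cases h1 : a = y <;> by_cases h2 : b = y
      · rw [h1, h2]
      · subst h1
        rw [Function.update_self, Function.update_of_ne h2] at hab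
        exact absurd ⟨b, hb.resolve_left h2, hab.symm⟩ hy
      · subst h2
        rw [Function.update_self, Function.update_of_ne h1] at hab
        exact absurd ⟨a, ha.resolve_left h1, hab⟩ hy
      · rw [Function.update_of_ne h1, Function.update_of_ne h2] at hab
        exact hf (ha.resolve_left h1) (hb.resolve_left h2) hab
    have hmem : ∀ x ∈ insert y I, x ∈ A (Function.update f y (g y) x) := by
      intro x hx
      by_cases h1 : x = y
      · subst h1
        rw [Function.update_self]
        exact hgA x hyJ
      · rw [Function.update_of_ne h1]
        exact hfA x (hx.resolve_left h1)
    by_cases hyI : y ∈ I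
    · rw [Set.insert_eq_of_mem hyI] at hinj hmem
      refine ih _ ?_ _ hinj hmem rfl
      rw [← hn]
      refine Set.ncard_lt_ncard ?_ (hJfin.subset (Set.sep_subset _ _))
      refine ⟨?_, fun hsub => ?_⟩
      · rintro x ⟨hxJ, hx⟩
        by_cases h1 : x = y
        · subst h1
          simp at hx
        · rw [Function.update_of_ne h1] at hx
          exact ⟨hxJ, hx⟩
      · have h2 : y ∈ {x ∈ J | f x ≠ g x} := ⟨hyJ, fun h => hy ⟨y, hyI, h⟩⟩
        have h3 := (hsub h2).2
        simp at h3
    · exact ⟨y, hyJ, hyI, IsPartialTransversal.of_injOn _ hinj hmem⟩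

/-- The transversal matroid on the finite ground set `E` presented by the family `A`: its
independent sets are the partial transversals of `A` that are contained in `E`. -/
def transversalMatroid {α ι : Type*} (E : Set α) (hE : E.Finite) (A : ι → Set α) : Matroid α :=
  (IndepMatroid.ofFinite hE (fun I => I ⊆ E ∧ IsPartialTransversal A I)
    ⟨Set.empty_subset E, fun x => x.2.elim, fun x => x.2.elim, fun x => x.2.elim⟩
    (fun _ _ hJ h => ⟨h.trans hJ.1, hJ.2.subset h⟩)
    (fun _ _ hI hJ hlt => by
      obtain ⟨e, heJ, heI, h⟩ := hI.2.augment (hE.subset hI.1) (hE.subset hJ.1) hJ.2 hlt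
      exact ⟨e, heJ, heI, Set.insert_subset (hJ.1 heJ) hI.1, h⟩)
    (fun _ hI => hI.1)).matroid

/-- The incidence function `n(X) = {i : X ∩ A i ≠ ∅}` of a family `A`. -/
def incidence {α ι : Type*} (A : ι → Set α) (X : Set α) : Set ι :=
  {i | (X ∩ A i).Nonempty}

/-- A matroid is connected if any two distinct elements lie in a common circuit. -/
def IsConnected {α : Type*} (M : Matroid α) : Prop :=
  ∀ x ∈ M.E, ∀ y ∈ M.E, x ≠ y → ∃ C, M.IsCircuit C ∧ x ∈ C ∧ y ∈ C

/-- A matroid is uniform if, for some `k`, its independent sets are the subsets of the ground set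
with at most `k` elements. -/
def IsUniform {α : Type*} (M : Matroid α) : Prop :=
  ∃ k : ℕ, ∀ I ⊆ M.E, (M.Indep I ↔ I.encard ≤ k)

/-- The ordered pair `(X, Y)` is a partition of the ground set into two sets with at least `k`
elements each, where `k` is positive. -/
def IsSplitting {α : Type*} (M : Matroid α) (k : ℕ) (X Y : Set α) : Prop :=
  1 ≤ k ∧ X ∪ Y = M.E ∧ Disjoint X Y ∧ (k : ℕ∞) ≤ X.encard ∧ (k : ℕ∞) ≤ Y.encard

/-- A `k`-separation: `r(X) + r(Y) ≤ r(M) + k - 1`. -/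
def IsSeparation {α : Type*} (M : Matroid α) (k : ℕ) (X Y : Set α) : Prop :=
  IsSplitting M k X Y ∧ M.eRk X + M.eRk Y + 1 ≤ M.eRank + k

/-- An exact `k`-separation: `r(X) + r(Y) = r(M) + k - 1`. -/
def IsExactSeparation {α : Type*} (M : Matroid α) (k : ℕ) (X Y : Set α) : Prop :=
  IsSplitting M k X Y ∧ M.eRk X + M.eRk Y + 1 = M.eRank + k

/-- The Tutte connectivity: the least positive integer `k` such that `M` has a `k`-separation,
and `∞` if there is none. -/
noncomputable def tutteConnectivity {α : Type*} (M : Matroid α) : ℕ∞ :=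
  ⨅ (k : ℕ) (_ : ∃ X Y, IsSeparation M k X Y), (k : ℕ∞)

/-- A fundamental flat of a connected matroid `M`: a connected flat `X` with more than one element
and rank less than `r(M)` that meets some spanning circuit of `M` in a basis of `X`. -/
def IsFundamentalFlat {α : Type*} (M : Matroid α) (X : Set α) : Prop :=
  IsConnected M ∧ M.IsFlat X ∧ IsConnected (M.restrict X) ∧ 1 < X.encard ∧ M.eRk X < M.eRank ∧
    ∃ C, M.IsCircuit C ∧ M.Spanning C ∧ M.IsBasis (X ∩ C) X

/-! ### Lattice paths -/

/-- The steps `E = (1,0)` and `N = (0,1)`. -/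
inductive Step : Type
  | E : Step
  | N : Step
  deriving DecidableEq

/-- A lattice path from `(0,0)` to `(m,r)`, as a word in the alphabet `{E, N}`. -/
structure LatticePath (m r : ℕ) where
  word : List Step
  count_E : word.count Step.E = m
  count_N : word.count Step.N = r

namespace LatticePath

/-- Step number `j` of `P` is `s`; steps are numbered from `1`. -/
def HasStep {m r : ℕ} (P : LatticePath m r) (j : ℕ) (s : Step) : Prop :=
  1 ≤ j ∧ P.word[j - 1]? = some s

/-- The height (second coordinate) of the point of `P` reached after `j` steps. -/
def height {m r : ℕ} (P : LatticePath m r) (j : ℕ) : ℕ :=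
  (P.word.take j).count Step.N

/-- `P` never goes above `Q`: since the points reached after `j` steps lie on the common line
`x + y = j`, this compares heights after equally many steps. -/
def NeverAbove {m r : ℕ} (P Q : LatticePath m r) : Prop :=
  ∀ j, P.height j ≤ Q.height j

/-- Step `j` of `P` is its `i`-th North step. -/
def IsNorthStep {m r : ℕ} (P : LatticePath m r) (i j : ℕ) : Prop :=
  P.HasStep j Step.N ∧ P.height j = i

/-- `P` has an `NE` corner at `h`: step `h` is North and step `h + 1` is East. -/
def NECorner {m r : ℕ} (P : LatticePath m r) (h : ℕ) : Prop :=
  P.HasStep h Step.N ∧ P.HasStep (h + 1) Step.E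

/-- `P` has an `EN` corner at `h`: step `h` is East and step `h + 1` is North. -/
def ENCorner {m r : ℕ} (P : LatticePath m r) (h : ℕ) : Prop :=
  P.HasStep h Step.E ∧ P.HasStep (h + 1) Step.N

end LatticePath

/-! ### Lattice path matroids -/

/-- The set `N_i` of all `j` such that step `j` is the `i`-th North step of some lattice path from
`(0,0)` to `(m,r)` that goes neither above `Q` nor below `P`. It is empty unless `1 ≤ i ≤ r`. -/
def standardSet {m r : ℕ} (P Q : LatticePath m r) (i : ℕ) : Set ℕ :=
  {j | ∃ R : LatticePath m r, P.NeverAbove R ∧ R.NeverAbove Q ∧ R.IsNorthStep i j}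

/-- The lattice path matroid `M[P,Q]`: the transversal matroid on the ground set
`{1, …, m + r}` presented by `(N_1, …, N_r)`. -/
def latticePathMatroid {m r : ℕ} (P Q : LatticePath m r) : Matroid ℕ :=
  transversalMatroid (Set.Icc 1 (m + r)) (Set.finite_Icc 1 (m + r))
    (fun i : Set.Icc 1 r => standardSet P Q i)

/-- The set `n(j)` of the indices `i` in `{1, …, r}` with `j ∈ N_i`. -/
def elementIncidence {m r : ℕ} (P Q : LatticePath m r) (j : ℕ) : Set (Set.Icc 1 r) :=
  incidence (fun i : Set.Icc 1 r => standardSet P Q i) {j}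

/-- The numbers `|n(j)|` over all `j` such that `P` has an `NE` corner at `j` or `Q` has an `EN`
corner at `j - 1`. (There is never a corner at `0`, so truncated subtraction is harmless.) -/
def cornerIncidenceSizes {m r : ℕ} (P Q : LatticePath m r) : Set ℕ :=
  {k | ∃ j : ℕ, (P.NECorner j ∨ Q.ENCorner (j - 1)) ∧ k = (elementIncidence P Q j).ncard}

end LPM

/-! Write n = m + r and record a path by its height after t steps, so that P and Q become functions
with P ≤ Q. Then N_i consists of the x in {1, …, n} with P(x - 1) < i ≤ Q(x), up-step sets of paths
between P and Q are bases, and |n(j)| = Q(j) - P(j - 1). For an NE corner of P at c take j = c, for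
an EN corner of Q at c take j = c + 1: both times |n(j)| = Q(c) - P(c) + 1. So k_M - 1 is the least
height difference at a corner. If there is no corner, then P = E^m N^r and Q = N^r E^m, and M is
uniform.

Upper bound: {1, …, c} has rank Q(c) and its complement has rank r - P(c), so a corner at c gives an
exact separation of order Q(c) - P(c) + 1. The initial part is a fundamental flat if the corner is
on Q, the final part if it is on P (`exists_isFundamentalFlat_isExactSeparation`).

Lower bound: put w = k_M - 1. Moving away from a corner, the paths can come closer than w only by
converging steadily to an end, whence Q(t) - P(t) ≥ min(w, t, n - t) (`min_le_height_sub`). This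
leaves room to trade up to w up-steps of Q for later elements (`indep_sdiff_union`). Trading on both
sides of a partition X, Y gives ρ(X) + ρ(Y) ≥ r + min(w, |X|, |Y|) (`exists_le_eRk_add`), which
excludes every separation of order at most w. -/

namespace LPM

/-! ### Paths as height functions -/

open Finset in
/-- The positions of the up-steps of a height function on `{0, …, n}`. -/
def upSteps (n : ℕ) (h : ℕ → ℕ) : Finset ℕ := {t ∈ Icc 1 n | h (t - 1) < h t}

/-- `h` is the height function of a lattice path with `n` steps that ends at height `r`. -/
structure IsHeight (n r : ℕ) (h : ℕ → ℕ) : Prop where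
  zero : h 0 = 0
  top : h n = r
  le_succ : ∀ t < n, h t ≤ h (t + 1)
  succ_le : ∀ t < n, h (t + 1) ≤ h t + 1

theorem mem_upSteps {n : ℕ} {h : ℕ → ℕ} {t : ℕ} :
    t ∈ upSteps n h ↔ (1 ≤ t ∧ t ≤ n) ∧ h (t - 1) < h t := by
  simp [upSteps]

namespace IsHeight

variable {n r : ℕ} {h : ℕ → ℕ}

theorem mono (hh : IsHeight n r h) {a b : ℕ} (hab : a ≤ b) (hb : b ≤ n) : h a ≤ h b := by
  induction b, hab using Nat.le_induction with
  | base => exact le_rfl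
  | succ b _ ih => exact (ih (by omega)).trans (hh.le_succ b (by omega))

theorem le_top (hh : IsHeight n r h) {b : ℕ} (hb : b ≤ n) : h b ≤ r :=
  (hh.mono hb le_rfl).trans_eq hh.top

theorem le_add (hh : IsHeight n r h) {a b : ℕ} (hab : a ≤ b) (hb : b ≤ n) :
    h b + a ≤ h a + b := by
  induction b, hab using Nat.le_induction with
  | base => exact le_rfl
  | succ b _ ih =>
    have := ih (by omega)
    have := hh.succ_le b (by omega)
    omega

theorem card_upSteps_inter (hh : IsHeight n r h) {a b : ℕ} (hab : a ≤ b) (hb : b ≤ n) :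
    (upSteps n h ∩ Finset.Ioc a b).card + h a = h b := by
  induction b, hab using Nat.le_induction with
  | base => simp
  | succ b hab ih =>
    have h1 := ih (by omega)
    have h2 := hh.le_succ b (by omega)
    have h3 := hh.succ_le b (by omega)
    have hI : Finset.Ioc a (b + 1) = insert (b + 1) (Finset.Ioc a b) := by
      ext t
      simp only [Finset.mem_Ioc, Finset.mem_insert]
      omega
    rw [hI]
    by_cases hs : h b < h (b + 1)
    · rw [Finset.inter_insert_of_mem (by simp [mem_upSteps, hs]; omega),
        Finset.card_insert_of_notMem (by simp)]
      omega
    · rw [Finset.inter_insert_of_notMem (by simp [mem_upSteps, hs])]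
      omega

theorem card_upSteps (hh : IsHeight n r h) : (upSteps n h).card = r := by
  have h1 := hh.card_upSteps_inter (Nat.zero_le n) le_rfl
  rw [hh.zero, hh.top] at h1
  rw [← h1, Finset.inter_eq_left.2]
  · simp
  · intro t ht
    have := mem_upSteps.1 ht
    simp
    omega

end IsHeight

namespace LatticePath

variable {m r : ℕ} (P : LatticePath m r)

theorem length_word : P.word.length = m + r := by
  have h : ∀ l : List Step, l.length = l.count Step.E + l.count Step.N := by
    intro l
    induction l with
    | nil => rfl
    | cons s l ih => cases s <;> simp [ih] <;> omega
  rw [h, P.count_E, P.count_N]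

theorem height_succ (t : ℕ) :
    P.height (t + 1) = P.height t + if P.word[t]? = some Step.N then 1 else 0 := by
  unfold height
  rw [List.take_add_one, List.count_append]
  rcases P.word[t]? with _ | s
  · simp
  · cases s <;> simp

theorem height_of_le {t : ℕ} (ht : m + r ≤ t) : P.height t = r := by
  unfold height
  rw [List.take_of_length_le (by rw [P.length_word]; exact ht), P.count_N]

theorem isHeight : IsHeight (m + r) r P.height where
  zero := by simp [height]
  top := P.height_of_le le_rfl
  le_succ t _ := by rw [P.height_succ]; omega
  succ_le t _ := by rw [P.height_succ]; split_ifs <;> omega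

theorem hasStep_N_iff {t : ℕ} :
    P.HasStep t Step.N ↔ 1 ≤ t ∧ t ≤ m + r ∧ P.height (t - 1) < P.height t := by
  unfold HasStep
  rcases t with _ | t
  · simp
  · have h1 := P.height_succ t
    have h2 := P.length_word
    simp only [Nat.add_sub_cancel, h1]
    constructor
    · rintro ⟨-, h⟩
      obtain ⟨h3, -⟩ := List.getElem?_eq_some_iff.1 h
      simp [h]
      omega
    · rintro ⟨-, -, h⟩
      refine ⟨by omega, ?_⟩
      by_contra h3
      simp [h3] at h

theorem hasStep_E_iff {t : ℕ} :
    P.HasStep t Step.E ↔ 1 ≤ t ∧ t ≤ m + r ∧ P.height (t - 1) = P.height t := by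
  unfold HasStep
  rcases t with _ | t
  · simp
  · have h1 := P.height_succ t
    have h2 := P.length_word
    simp only [Nat.add_sub_cancel, h1]
    constructor
    · rintro ⟨-, h⟩
      obtain ⟨h3, -⟩ := List.getElem?_eq_some_iff.1 h
      simp [h]
      omega
    · rintro ⟨-, h3, h⟩
      refine ⟨by omega, ?_⟩
      have h4 : t < P.word.length := by omega
      rw [List.getElem?_eq_getElem h4] at h ⊢
      rcases hs : P.word[t] with _ | _
      · rfl
      · simp [hs] at h

theorem neCorner_iff {t : ℕ} : P.NECorner t ↔ 1 ≤ t ∧ t < m + r ∧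
    P.height (t - 1) < P.height t ∧ P.height t = P.height (t + 1) := by
  simp only [NECorner, hasStep_N_iff, hasStep_E_iff, Nat.add_sub_cancel]
  constructor <;> intro h <;> refine ⟨?_, ?_⟩ <;> omega

theorem enCorner_iff {t : ℕ} : P.ENCorner t ↔ 1 ≤ t ∧ t < m + r ∧
    P.height (t - 1) = P.height t ∧ P.height t < P.height (t + 1) := by
  simp only [ENCorner, hasStep_N_iff, hasStep_E_iff, Nat.add_sub_cancel]
  constructor <;> intro h <;> refine ⟨?_, ?_⟩ <;> omega

theorem neverAbove_of_le {P Q : LatticePath m r}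
    (h : ∀ t ≤ m + r, P.height t ≤ Q.height t) : P.NeverAbove Q := by
  intro t
  rcases le_total t (m + r) with ht | ht
  · exact h t ht
  · rw [P.height_of_le ht, Q.height_of_le ht]

theorem exists_height_eq {h : ℕ → ℕ} (hh : IsHeight (m + r) r h) :
    ∃ R : LatticePath m r, ∀ t ≤ m + r, R.height t = h t := by
  let f : ℕ → Step := fun t => if h t < h (t + 1) then Step.N else Step.E
  have hN : ∀ t ≤ m + r, ((List.range t).map f).count Step.N = h t := by
    intro t
    induction t with
    | zero => simp [hh.zero]
    | succ t ih =>
      intro ht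
      have h1 := hh.le_succ t (by omega)
      have h2 := hh.succ_le t (by omega)
      rw [List.range_succ, List.map_append, List.count_append, ih (by omega)]
      by_cases h3 : h t < h (t + 1)
      · simp [f, h3]; omega
      · simp [f, h3]; omega
  have hE : ∀ t ≤ m + r, ((List.range t).map f).count Step.E + h t = t := by
    intro t
    induction t with
    | zero => simp [hh.zero]
    | succ t ih =>
      intro ht
      have h1 := hh.le_succ t (by omega)
      have h2 := hh.succ_le t (by omega)
      have h4 := ih (by omega)
      rw [List.range_succ, List.map_append, List.count_append, List.map_singleton,
        List.count_singleton]
      by_cases h3 : h t < h (t + 1)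
      · have h5 : (f t == Step.E) = false := by simp [f, h3]
        rw [h5, if_neg (by simp)]
        omega
      · have h5 : (f t == Step.E) = true := by simp [f, h3]
        rw [h5, if_pos rfl]
        omega
  have hE' := hE _ le_rfl
  have hN' := hN _ le_rfl
  rw [hh.top] at hE' hN'
  refine ⟨⟨(List.range (m + r)).map f, by omega, hN'⟩, fun t ht => ?_⟩
  rw [height, ← hN t ht, ← List.map_take, List.take_range, min_eq_left ht]

end LatticePath

/-! ### Independence, rank bounds and connectedness in terms of heights -/

section

variable {m r : ℕ} {P Q : LatticePath m r}

theorem mem_standardSet_iff (hPQ : P.NeverAbove Q) {i x : ℕ} :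
    x ∈ standardSet P Q i ↔
      (1 ≤ x ∧ x ≤ m + r) ∧ P.height (x - 1) < i ∧ i ≤ Q.height x := by
  constructor
  · rintro ⟨R, hPR, hRQ, hs, rfl⟩
    rw [R.hasStep_N_iff] at hs
    exact ⟨⟨hs.1, hs.2.1⟩, (hPR _).trans_lt hs.2.2, hRQ x⟩
  · rintro ⟨⟨hx1, hxn⟩, hi1, hi2⟩
    have hp := P.isHeight
    have hq := Q.isHeight
    have hx : ∃ y, x = y + 1 := ⟨x - 1, by omega⟩
    obtain ⟨y, rfl⟩ := hx
    rw [Nat.add_sub_cancel] at hi1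
    have hqx := hq.succ_le y (by omega)
    have hpx := hp.succ_le y (by omega)
    have hir : Q.height (y + 1) ≤ r := hq.le_top hxn
    -- The path follows Q up to height i - 1, waits there, goes up at step y + 1, then stays at
    -- height i until P pushes it up.
    let h : ℕ → ℕ := fun t => if t ≤ y then min (Q.height t) (i - 1) else max i (P.height t)
    have hh : IsHeight (m + r) r h := by
      refine ⟨by simp [h, hq.zero], ?_, fun t ht => ?_, fun t ht => ?_⟩
      · simp only [h, hp.top]
        split_ifs <;> omega
      all_goals
        have h1 := hq.le_succ t ht
        have h2 := hq.succ_le t ht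
        have h3 := hp.le_succ t ht
        have h4 := hp.succ_le t ht
        simp only [h]
        rcases lt_trichotomy t y with h5 | rfl | h5
        · rw [if_pos (by omega), if_pos (by omega)]; omega
        · rw [if_pos le_rfl, if_neg (by omega)]; omega
        · rw [if_neg (by omega), if_neg (by omega)]; omega
    obtain ⟨R, hR⟩ := LatticePath.exists_height_eq hh
    refine ⟨R, LatticePath.neverAbove_of_le fun t ht => ?_,
      LatticePath.neverAbove_of_le fun t ht => ?_, R.hasStep_N_iff.2 ⟨hx1, hxn, ?_⟩, ?_⟩
    · rw [hR t ht]
      have h1 := hPQ t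
      simp only [h]
      split_ifs with h2
      · have := hp.mono h2 (by omega)
        omega
      · omega
    · rw [hR t ht]
      have h1 := hPQ t
      simp only [h]
      split_ifs with h2
      · omega
      · have := hq.mono (show y + 1 ≤ t by omega) ht
        omega
    · rw [hR _ (by omega), hR _ hxn]
      simp [h]
      omega
    · rw [hR _ hxn]
      simp [h]
      omega

theorem ncard_elementIncidence (hPQ : P.NeverAbove Q) {j : ℕ} (hj : 1 ≤ j) (hjn : j ≤ m + r) :
    (elementIncidence P Q j).ncard = Q.height j - P.height (j - 1) := by
  rw [← Set.ncard_image_of_injective _ Subtype.val_injective]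
  have : Subtype.val '' elementIncidence P Q j =
      (Finset.Ioc (P.height (j - 1)) (Q.height j) : Finset ℕ) := by
    ext i
    have hir : Q.height j ≤ r := Q.isHeight.le_top hjn
    simp only [elementIncidence, incidence, Set.singleton_inter_nonempty, mem_standardSet_iff hPQ,
      Set.mem_image, Set.mem_ofPred_eq, Finset.coe_Ioc, Set.mem_Ioc]
    constructor
    · rintro ⟨i, ⟨-, h⟩, rfl⟩
      exact h
    · intro h
      exact ⟨⟨i, by simp; omega⟩, ⟨⟨hj, hjn⟩, h⟩, rfl⟩
  rw [this, Set.ncard_coe_finset, Nat.card_Ioc]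

theorem latticePathMatroid_ground : (latticePathMatroid P Q).E = Set.Icc 1 (m + r) := rfl

theorem indep_latticePathMatroid_iff (hPQ : P.NeverAbove Q) {I : Set ℕ} :
    (latticePathMatroid P Q).Indep I ↔ I ⊆ Set.Icc 1 (m + r) ∧
      ∃ f : ℕ → ℕ, Set.InjOn f I ∧
        ∀ x ∈ I, P.height (x - 1) < f x ∧ f x ≤ Q.height x := by
  have h1 : (latticePathMatroid P Q).Indep I ↔ I ⊆ Set.Icc 1 (m + r) ∧
    IsPartialTransversal (fun i : Set.Icc 1 r => standardSet P Q i) I := Iff.rfl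
  rw [h1]
  refine and_congr_right fun hI => ⟨?_, ?_⟩
  · rintro ⟨f, hf, hA⟩
    classical
    refine ⟨fun x => if hx : x ∈ I then f ⟨x, hx⟩ else 0, ?_, ?_⟩
    · intro x hx y hy hxy
      simp only [hx, hy, dif_pos] at hxy
      exact congrArg Subtype.val (hf (Subtype.ext hxy))
    · intro x hx
      simp only [hx, dif_pos]
      exact ((mem_standardSet_iff hPQ).1 (hA ⟨x, hx⟩)).2
  · rintro ⟨f, hf, hA⟩
    refine ⟨fun x => ⟨f x, ?_⟩, fun x y hxy => ?_, fun x => ?_⟩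
    · have h2 := hA x x.2
      have h3 : Q.height x ≤ r := Q.isHeight.le_top (hI x.2).2
      simp
      omega
    · exact Subtype.ext (hf x.2 y.2 (congrArg Subtype.val hxy))
    · exact (mem_standardSet_iff hPQ).2 ⟨hI x.2, hA x x.2⟩

theorem indep_upSteps (hPQ : P.NeverAbove Q) {h : ℕ → ℕ} (hh : IsHeight (m + r) r h)
    (hP : ∀ t ≤ m + r, P.height t ≤ h t) (hQ : ∀ t ≤ m + r, h t ≤ Q.height t) :
    (latticePathMatroid P Q).Indep (upSteps (m + r) h) := by
  rw [indep_latticePathMatroid_iff hPQ]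
  -- Each up-step is matched with its own height.
  refine ⟨fun x hx => (mem_upSteps.1 hx).1, h, ?_, fun x hx => ?_⟩
  · have key : ∀ x ∈ upSteps (m + r) h, ∀ y ∈ upSteps (m + r) h, x < y → h x < h y := by
      intro x _ y hy hxy
      have h1 := mem_upSteps.1 hy
      exact (hh.mono (show x ≤ y - 1 by omega) (by omega)).trans_lt h1.2
    intro x hx y hy hxy
    rcases lt_trichotomy x y with h1 | h1 | h1
    · exact absurd hxy (key x hx y hy h1).ne
    · exact h1
    · exact absurd hxy (key y hy x hx h1).ne'
  · have h1 := mem_upSteps.1 hx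
    have h2 := hP (x - 1) (by omega)
    have h3 := hQ x h1.1.2
    omega

/-- By monotonicity, the distinct labels matched with elements of (a, b] all lie in (P a, Q b]. -/
theorem eRk_Ioc_le (hPQ : P.NeverAbove Q) {a b : ℕ} (hb : b ≤ m + r) :
    (latticePathMatroid P Q).eRk (Set.Ioc a b) ≤ ((Q.height b - P.height a : ℕ) : ℕ∞) := by
  rw [Matroid.eRk_le_iff]
  intro I hI hi
  obtain ⟨-, f, hf, hfI⟩ := (indep_latticePathMatroid_iff hPQ).1 hi
  have hmaps : f '' I ⊆ (Finset.Ioc (P.height a) (Q.height b) : Finset ℕ) := by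
    rintro _ ⟨x, hx, rfl⟩
    have h1 := hI hx
    have h2 := hfI x hx
    have h3 := P.isHeight.mono (show a ≤ x - 1 by have := h1.1; omega) (by have := h1.2; omega)
    have h4 := Q.isHeight.mono h1.2 hb
    simp
    omega
  rw [← hf.encard_image]
  refine (Set.encard_le_encard hmaps).trans ?_
  rw [Set.encard_coe_eq_coe_finsetCard, Nat.card_Ioc]

/-- If the paths met at t, elements up to t would use only labels at most Q t, and later ones only
labels above it. Matchings of the two sides could then be glued, so no circuit could contain both t
and t + 1. -/
theorem height_lt_of_isConnected (hPQ : P.NeverAbove Q)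
    (hconn : IsConnected (latticePathMatroid P Q)) {t : ℕ} (ht : 0 < t) (htn : t < m + r) :
    P.height t < Q.height t := by
  by_contra hcon
  have heq : Q.height t = P.height t := le_antisymm (not_lt.1 hcon) (hPQ t)
  obtain ⟨C, hC, hx, hy⟩ := hconn t (by simp [latticePathMatroid_ground]; omega) (t + 1)
    (by simp [latticePathMatroid_ground]; omega) (by omega)
  have hCE := hC.subset_ground
  have h1 : (latticePathMatroid P Q).Indep (C ∩ Set.Iic t) := by
    refine hC.ssubset_indep ⟨Set.inter_subset_left, fun h => ?_⟩
    have := (h hy).2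
    simp at this
  have h2 : (latticePathMatroid P Q).Indep (C ∩ Set.Ioi t) := by
    refine hC.ssubset_indep ⟨Set.inter_subset_left, fun h => ?_⟩
    have := (h hx).2
    simp at this
  obtain ⟨-, f, hf, hfI⟩ := (indep_latticePathMatroid_iff hPQ).1 h1
  obtain ⟨-, g, hg, hgI⟩ := (indep_latticePathMatroid_iff hPQ).1 h2
  refine hC.not_indep ((indep_latticePathMatroid_iff hPQ).2 ⟨hCE,
    fun x => if x ≤ t then f x else g x, ?_, ?_⟩)
  · have hle : ∀ x ∈ C, x ≤ t → f x ≤ Q.height t := fun x hxC hxt =>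
      (hfI x ⟨hxC, hxt⟩).2.trans (Q.isHeight.mono hxt htn.le)
    have hlt : ∀ x ∈ C, ¬ x ≤ t → Q.height t < g x := fun x hxC hxt => by
      rw [heq]
      refine lt_of_le_of_lt (P.isHeight.mono (show t ≤ x - 1 by omega) ?_)
        (hgI x ⟨hxC, not_le.1 hxt⟩).1
      have := (hCE hxC).2
      omega
    intro x hxC y hyC hxy
    by_cases h3 : x ≤ t <;> by_cases h4 : y ≤ t <;> simp only [h3, h4, if_true, if_false] at hxy
    · exact hf ⟨hxC, h3⟩ ⟨hyC, h4⟩ hxy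
    · have := hle x hxC h3
      have := hlt y hyC h4
      omega
    · have := hle y hyC h4
      have := hlt x hxC h3
      omega
    · exact hg ⟨hxC, not_le.1 h3⟩ ⟨hyC, not_le.1 h4⟩ hxy
  · intro x hxC
    by_cases h3 : x ≤ t <;> simp only [h3, if_true, if_false]
    · exact hfI x ⟨hxC, h3⟩
    · exact hgI x ⟨hxC, not_le.1 h3⟩

end

/-! ### Moving an up-step, and paths between two paths -/

namespace IsHeight

variable {n r : ℕ} {h : ℕ → ℕ} {x y : ℕ}

/-- An elementary basis exchange that postpones an up-step. The truncated subtraction is harmless,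
since h is positive from its up-step x onwards. -/
theorem swap_down (hh : IsHeight n r h) (hx : x ∈ upSteps n h) (hxy : x < y) (hyn : y ≤ n)
    (hy : h (y - 1) = h y) :
    IsHeight n r (fun t => if x ≤ t ∧ t < y then h t - 1 else h t) ∧
      upSteps n (fun t => if x ≤ t ∧ t < y then h t - 1 else h t) =
        insert y ((upSteps n h).erase x) := by
  obtain ⟨⟨hx1, hxn⟩, hxs⟩ := mem_upSteps.1 hx
  have h0 : ∀ t ≤ n, x ≤ t → h x ≤ h t := fun t ht hxt => hh.mono hxt ht
  refine ⟨⟨?_, ?_, fun t ht => ?_, fun t ht => ?_⟩, ?_⟩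
  · rw [if_neg (by omega), hh.zero]
  · rw [if_neg (by omega), hh.top]
  · have h1 := hh.le_succ t ht
    have h2 := h0 t (by omega)
    rcases eq_or_ne (t + 1) x with rfl | h4
    · rw [Nat.add_sub_cancel] at hxs
      split_ifs <;> omega
    · split_ifs <;> omega
  · have h1 := hh.succ_le t ht
    have h2 := h0 t (by omega)
    rcases eq_or_ne (t + 1) y with rfl | h4
    · rw [Nat.add_sub_cancel] at hy
      split_ifs <;> omega
    · split_ifs <;> omega
  · ext t
    simp only [mem_upSteps, Finset.mem_insert, Finset.mem_erase]
    by_cases ht : 1 ≤ t ∧ t ≤ n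
    · have h1 := hh.le_succ (t - 1) (by omega)
      have h2 := hh.succ_le (t - 1) (by omega)
      rw [Nat.sub_add_cancel ht.1] at h1 h2
      have h3 := h0 t ht.2
      have h4 := h0 (t - 1) (by omega)
      rcases eq_or_ne t x with rfl | h5
      · split_ifs <;> omega
      rcases eq_or_ne t y with rfl | h6
      · split_ifs <;> omega
      split_ifs <;> omega
    · constructor
      · omega
      · omega

theorem swap_up (hh : IsHeight n r h) (hx : x ∈ upSteps n h) (hy1 : 1 ≤ y) (hyx : y < x)
    (hy : h (y - 1) = h y) :
    IsHeight n r (fun t => if y ≤ t ∧ t < x then h t + 1 else h t) ∧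
      upSteps n (fun t => if y ≤ t ∧ t < x then h t + 1 else h t) =
        insert y ((upSteps n h).erase x) := by
  obtain ⟨⟨hx1, hxn⟩, hxs⟩ := mem_upSteps.1 hx
  refine ⟨⟨?_, ?_, fun t ht => ?_, fun t ht => ?_⟩, ?_⟩
  · rw [if_neg (by omega), hh.zero]
  · rw [if_neg (by omega), hh.top]
  · have h1 := hh.le_succ t ht
    rcases eq_or_ne (t + 1) x with rfl | h4
    · rw [Nat.add_sub_cancel] at hxs
      split_ifs <;> omega
    · split_ifs <;> omega
  · have h1 := hh.succ_le t ht
    rcases eq_or_ne (t + 1) y with rfl | h4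
    · rw [Nat.add_sub_cancel] at hy
      split_ifs <;> omega
    · split_ifs <;> omega
  · ext t
    simp only [mem_upSteps, Finset.mem_insert, Finset.mem_erase]
    by_cases ht : 1 ≤ t ∧ t ≤ n
    · have h1 := hh.le_succ (t - 1) (by omega)
      have h2 := hh.succ_le (t - 1) (by omega)
      rw [Nat.sub_add_cancel ht.1] at h1 h2
      rcases eq_or_ne t x with rfl | h5
      · split_ifs <;> omega
      rcases eq_or_ne t y with rfl | h6
      · split_ifs <;> omega
      split_ifs <;> omega
    · constructor
      · omega
      · omega

/-- Between two lattice paths that are disjoint on `[x, y)` there is a path that goes up at `x`,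
does not go up at `y`, and stays strictly above the lower one on `[x, y)`. -/
theorem exists_between {p q : ℕ → ℕ} (hp : IsHeight n r p) (hq : IsHeight n r q)
    (hpq : ∀ t ≤ n, p t ≤ q t) (hx1 : 1 ≤ x) (hxy : x < y) (hyn : y ≤ n)
    (hlt : ∀ t, x ≤ t → t < y → p t < q t) :
    ∃ h, IsHeight n r h ∧ (∀ t ≤ n, p t ≤ h t) ∧ (∀ t ≤ n, h t ≤ q t) ∧ x ∈ upSteps n h ∧
      h (y - 1) = h y ∧ ∀ t, x ≤ t → t < y → p t < h t := by
  obtain ⟨x, rfl⟩ : ∃ z, x = z + 1 := ⟨x - 1, by omega⟩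
  obtain ⟨y, rfl⟩ : ∃ z, y = z + 1 := ⟨y - 1, by omega⟩
  have hpx := hp.le_succ x (by omega)
  have hqx := hq.succ_le x (by omega)
  have hltx := hlt (x + 1) le_rfl hxy
  have hpy := hp.succ_le y (by omega)
  have hqy := hq.le_succ y (by omega)
  have hlty := hlt y (by omega) (by omega)
  have hqr := hq.le_top hyn
  have hqxy := hq.mono hxy.le hyn
  have hmp : ∀ a b, a ≤ b → b ≤ n → p a ≤ p b := fun a b => hp.mono
  have hmq : ∀ a b, a ≤ b → b ≤ n → q a ≤ q b := fun a b => hq.mono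
  -- Here x and y have been shifted down by one. The path follows q up to height q (x + 1) - 1,
  -- rises to q at step x + 1, and then stays as low as it can strictly above p until y. The value
  -- reached at y already dominates p (y + 1), so step y + 1 is flat.
  refine ⟨fun t => if t ≤ x then min (q t) (q (x + 1) - 1) else if t ≤ y then
    max (q (x + 1)) (p t + 1) else max (max (q (x + 1)) (p y + 1)) (p t),
    ⟨?_, ?_, fun t ht => ?_, fun t ht => ?_⟩, fun t ht => ?_, fun t ht => ?_, ?_, ?_,
    fun t h1 h2 => ?_⟩
  · simp [hq.zero]
  · rw [if_neg (by omega), if_neg (by omega), hp.top]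
    omega
  · have h1 := hp.le_succ t ht
    have h2 := hq.le_succ t ht
    rcases eq_or_ne t x with rfl | h3
    · split_ifs <;> omega
    rcases eq_or_ne t y with rfl | h4
    · split_ifs <;> omega
    split_ifs <;> omega
  · have h1 := hp.succ_le t ht
    have h2 := hq.succ_le t ht
    rcases eq_or_ne t x with rfl | h3
    · split_ifs <;> omega
    rcases eq_or_ne t y with rfl | h4
    · split_ifs <;> omega
    split_ifs <;> omega
  · have h1 := hpq t ht
    have h2 := hmp t x
    simp only
    split_ifs <;> omega
  · have h1 := hpq t ht
    have h2 := hlt t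
    have h3 := hmq (x + 1) t
    have h4 := hmq (y + 1) t
    simp only
    split_ifs <;> omega
  · rw [mem_upSteps, Nat.add_sub_cancel]
    refine ⟨by omega, ?_⟩
    rw [if_pos le_rfl, if_neg (by omega), if_pos (by omega)]
    omega
  · simp only [Nat.add_sub_cancel]
    rw [if_neg (by omega), if_pos le_rfl, if_neg (by omega), if_neg (by omega)]
    omega
  · simp only
    rw [if_neg (by omega), if_pos (by omega)]
    omega

end IsHeight

/-! ### Bases and ranks of intervals -/

section

variable {m r : ℕ} {P Q : LatticePath m r} {h : ℕ → ℕ}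

theorem coe_insert_erase (s : Finset ℕ) (x y : ℕ) :
    ((insert y (s.erase x) : Finset ℕ) : Set ℕ) = insert y ((s : Set ℕ) \ {x}) := by
  simp

theorem indep_swap_down (hPQ : P.NeverAbove Q) (hh : IsHeight (m + r) r h)
    (hP : ∀ t ≤ m + r, P.height t ≤ h t) (hQ : ∀ t ≤ m + r, h t ≤ Q.height t) {x y : ℕ}
    (hx : x ∈ upSteps (m + r) h) (hxy : x < y) (hyn : y ≤ m + r) (hy : h (y - 1) = h y)
    (hlt : ∀ t, x ≤ t → t < y → P.height t < h t) :
    (latticePathMatroid P Q).Indep (insert y ((upSteps (m + r) h : Set ℕ) \ {x})) := by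
  obtain ⟨h1, h2⟩ := hh.swap_down hx hxy hyn hy
  rw [← coe_insert_erase, ← h2]
  refine indep_upSteps hPQ h1 (fun t ht => ?_) (fun t ht => ?_)
  · have := hP t ht
    have := hlt t
    split_ifs <;> omega
  · have := hQ t ht
    split_ifs <;> omega

theorem indep_swap_up (hPQ : P.NeverAbove Q) (hh : IsHeight (m + r) r h)
    (hP : ∀ t ≤ m + r, P.height t ≤ h t) (hQ : ∀ t ≤ m + r, h t ≤ Q.height t) {x y : ℕ}
    (hx : x ∈ upSteps (m + r) h) (hy1 : 1 ≤ y) (hyx : y < x) (hy : h (y - 1) = h y)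
    (hlt : ∀ t, y ≤ t → t < x → h t < Q.height t) :
    (latticePathMatroid P Q).Indep (insert y ((upSteps (m + r) h : Set ℕ) \ {x})) := by
  obtain ⟨h1, h2⟩ := hh.swap_up hx hy1 hyx hy
  rw [← coe_insert_erase, ← h2]
  refine indep_upSteps hPQ h1 (fun t ht => ?_) (fun t ht => ?_)
  · have := hP t ht
    split_ifs <;> omega
  · have := hQ t ht
    have := hlt t
    split_ifs <;> omega

/-- The path has h b - h a up-steps in (a, b], which by `hrk` reaches the bound of `eRk_Ioc_le`. For
initial intervals the path Q attains it, for final ones P. -/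
theorem isBasis_upSteps_inter (hPQ : P.NeverAbove Q) (hh : IsHeight (m + r) r h)
    (hP : ∀ t ≤ m + r, P.height t ≤ h t) (hQ : ∀ t ≤ m + r, h t ≤ Q.height t) {a b : ℕ}
    (hab : a ≤ b) (hb : b ≤ m + r) (hrk : Q.height b - P.height a ≤ h b - h a) :
    (latticePathMatroid P Q).IsBasis ((upSteps (m + r) h : Set ℕ) ∩ Set.Ioc a b)
      (Set.Ioc a b) := by
  have hi := (indep_upSteps hPQ hh hP hQ).inter_right (Set.Ioc a b)
  refine hi.isBasis_of_eRk_ge ((Finset.finite_toSet _).inter_of_left _) Set.inter_subset_right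
    ?_ ?_
  · rw [hi.eRk_eq_encard, ← Finset.coe_Ioc, ← Finset.coe_inter, Set.encard_coe_eq_coe_finsetCard,
      Finset.coe_Ioc]
    refine (eRk_Ioc_le hPQ hb).trans ?_
    have := hh.card_upSteps_inter hab hb
    exact_mod_cast (by omega)
  · intro t ht
    rw [latticePathMatroid_ground]
    exact ⟨by have := ht.1; omega, ht.2.trans hb⟩

theorem eRk_Ioc_eq (hPQ : P.NeverAbove Q) (hh : IsHeight (m + r) r h)
    (hP : ∀ t ≤ m + r, P.height t ≤ h t) (hQ : ∀ t ≤ m + r, h t ≤ Q.height t) {a b : ℕ}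
    (hab : a ≤ b) (hb : b ≤ m + r) (hrk : Q.height b - P.height a ≤ h b - h a) :
    (latticePathMatroid P Q).eRk (Set.Ioc a b) = ((h b - h a : ℕ) : ℕ∞) := by
  have h1 := isBasis_upSteps_inter hPQ hh hP hQ hab hb hrk
  rw [h1.eRk_eq_encard, ← Finset.coe_Ioc, ← Finset.coe_inter, Set.encard_coe_eq_coe_finsetCard]
  have := hh.card_upSteps_inter hab hb
  exact_mod_cast (by omega)

theorem eRk_initial (hPQ : P.NeverAbove Q) {c : ℕ} (hc : c ≤ m + r) :
    (latticePathMatroid P Q).eRk (Set.Ioc 0 c) = (Q.height c : ℕ∞) := by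
  rw [eRk_Ioc_eq hPQ Q.isHeight (fun t _ => hPQ t) (fun t _ => le_rfl) (Nat.zero_le c) hc
    (by rw [P.isHeight.zero, Q.isHeight.zero]), Q.isHeight.zero, Nat.sub_zero]

theorem eRk_final (hPQ : P.NeverAbove Q) {c : ℕ} (hc : c ≤ m + r) :
    (latticePathMatroid P Q).eRk (Set.Ioc c (m + r)) = ((r - P.height c : ℕ) : ℕ∞) := by
  rw [eRk_Ioc_eq hPQ P.isHeight (fun t _ => le_rfl) (fun t _ => hPQ t) hc le_rfl
    (by rw [P.isHeight.top, Q.isHeight.top]), P.isHeight.top]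

theorem ground_eq_Ioc : (latticePathMatroid P Q).E = Set.Ioc 0 (m + r) := by
  rw [latticePathMatroid_ground]
  ext t
  simp [Nat.one_le_iff_ne_zero, Nat.pos_iff_ne_zero]

theorem eRank_latticePathMatroid (hPQ : P.NeverAbove Q) :
    (latticePathMatroid P Q).eRank = (r : ℕ∞) := by
  rw [Matroid.eRank_def, ground_eq_Ioc, eRk_initial hPQ le_rfl, Q.isHeight.top]

theorem isBase_upSteps (hPQ : P.NeverAbove Q) (hh : IsHeight (m + r) r h)
    (hP : ∀ t ≤ m + r, P.height t ≤ h t) (hQ : ∀ t ≤ m + r, h t ≤ Q.height t) :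
    (latticePathMatroid P Q).IsBase (upSteps (m + r) h) := by
  have hi := indep_upSteps hPQ hh hP hQ
  refine hi.isBase_of_eRk_ge (Finset.finite_toSet _) ?_
  rw [hi.eRk_eq_encard, Set.encard_coe_eq_coe_finsetCard, hh.card_upSteps,
    eRank_latticePathMatroid hPQ]

/-! ### Circuits, flats and fundamental flats -/

theorem _root_.Matroid.IsBase.isCircuit_insert {α : Type*} {M : Matroid α} {B : Set α} {y : α}
    (hB : M.IsBase B) (hy : y ∈ M.E) (hyB : y ∉ B)
    (hswap : ∀ x ∈ B, M.Indep (insert y (B \ {x}))) : M.IsCircuit (insert y B) := by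
  rw [Matroid.isCircuit_iff_dep_forall_sdiff_singleton_indep]
  refine ⟨hB.insert_dep ⟨hy, hyB⟩, ?_⟩
  rintro x (rfl | hx)
  · exact hB.indep.subset (by simp)
  · have hxy : y ≠ x := fun h => hyB (h ▸ hx)
    rw [← Set.insert_sdiff_singleton_comm hxy]
    exact hswap x hx

/-- A restriction of a lattice path matroid to an interval is connected if the interval is spanned
by paths between two bounding paths that meet only at its ends. -/
theorem isConnected_restrict_Ioc (hPQ : P.NeverAbove Q) {p q : ℕ → ℕ}
    (hp : IsHeight (m + r) r p) (hq : IsHeight (m + r) r q)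
    (hPp : ∀ t ≤ m + r, P.height t ≤ p t) (hpq : ∀ t ≤ m + r, p t ≤ q t)
    (hqQ : ∀ t ≤ m + r, q t ≤ Q.height t) {a b : ℕ} (hb : b ≤ m + r)
    (hlt : ∀ t, a < t → t < b → p t < q t)
    (hrk : Q.height b - P.height a ≤ p b - q a) :
    IsConnected ((latticePathMatroid P Q).restrict (Set.Ioc a b)) := by
  suffices H : ∀ x ∈ Set.Ioc a b, ∀ y ∈ Set.Ioc a b, x < y →
      ∃ C, ((latticePathMatroid P Q).restrict (Set.Ioc a b)).IsCircuit C ∧ x ∈ C ∧ y ∈ C by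
    intro x hx y hy hxy
    rcases hxy.lt_or_gt with h1 | h1
    · exact H x hx y hy h1
    · obtain ⟨C, hC, h2, h3⟩ := H y hy x hx h1
      exact ⟨C, hC, h3, h2⟩
  rintro x ⟨hax, hxb⟩ y ⟨hay, hyb⟩ hxy
  obtain ⟨h, hh, hph, hhq, hx, hy, hlt'⟩ := hp.exists_between hq hpq (by omega) hxy
    (hyb.trans hb) (fun t h1 h2 => hlt t (by omega) (by omega))
  have hPh : ∀ t ≤ m + r, P.height t ≤ h t := fun t ht => (hPp t ht).trans (hph t ht)
  have hhQ : ∀ t ≤ m + r, h t ≤ Q.height t := fun t ht => (hhq t ht).trans (hqQ t ht)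
  -- Since h b ≥ p b and h a ≤ q a, `hrk` makes every path between p and q meet the interval in a
  -- basis of it. The circuit sought is the fundamental circuit of y; it contains x because the
  -- up-step at x can be moved to y.
  have hbas := isBasis_upSteps_inter hPQ hh hPh hhQ (show a ≤ b by omega) hb (by
    have := hph b hb
    have := hhq a (by omega)
    omega)
  have hycl : y ∈ (latticePathMatroid P Q).closure ((upSteps (m + r) h : Set ℕ) ∩ Set.Ioc a b) := by
    rw [hbas.closure_eq_closure]
    exact Matroid.mem_closure_of_mem _ ⟨hay, hyb⟩ hbas.subset_ground
  have hyI : y ∉ (upSteps (m + r) h : Set ℕ) ∩ Set.Ioc a b := by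
    rintro ⟨h1, -⟩
    have := (mem_upSteps.1 h1).2
    omega
  refine ⟨_, (Matroid.restrict_isCircuit_iff hbas.subset_ground).2
    ⟨hbas.indep.fundCircuit_isCircuit hycl hyI, ?_⟩, ?_, Matroid.mem_fundCircuit _ _ _⟩
  · exact (Matroid.fundCircuit_subset_insert _ _ _).trans
      (Set.insert_subset ⟨hay, hyb⟩ Set.inter_subset_right)
  · rw [hbas.indep.mem_fundCircuit_iff hycl hyI]
    refine (indep_swap_down hPQ hh hPh hhQ hx hxy (hyb.trans hb) hy
      (fun t h1 h2 => (hPp t (by omega)).trans_lt (hlt' t h1 h2))).subset ?_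
    rintro t ⟨rfl | ht, htx⟩
    · exact Set.mem_insert _ _
    · exact Set.mem_insert_of_mem _ ⟨ht.1, htx⟩

theorem _root_.Matroid.IsBasis.isFlat_of_insert_indep {α : Type*} {M : Matroid α} {I F : Set α}
    (hI : M.IsBasis I F) (h : ∀ e ∈ M.E \ F, M.Indep (insert e I)) : M.IsFlat F := by
  rw [Matroid.isFlat_iff_closure_eq]
  refine Set.Subset.antisymm (fun e he => ?_) (M.subset_closure F hI.subset_ground)
  by_contra heF
  have heE : e ∈ M.E := M.closure_subset_ground F he
  rw [← hI.closure_eq_closure, hI.indep.mem_closure_iff'] at he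
  exact heF (hI.subset (he.2 (h e ⟨heE, heF⟩)))

/-- The corner makes Q rise right after c. Hence for any e beyond c there is room for a path that
keeps the up-steps of Q up to c and also goes up at e. -/
theorem isFlat_initial (hPQ : P.NeverAbove Q)
    (hlt : ∀ t, 0 < t → t < m + r → P.height t < Q.height t) {c : ℕ} (hc : Q.ENCorner c) :
    (latticePathMatroid P Q).IsFlat (Set.Ioc 0 c) := by
  obtain ⟨hc1, hcn, -, hc3⟩ := Q.enCorner_iff.1 hc
  have hp := P.isHeight
  have hq := Q.isHeight
  have hmp : ∀ a b, a ≤ b → b ≤ m + r → P.height a ≤ P.height b := fun a b => hp.mono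
  have hmq : ∀ a b, a ≤ b → b ≤ m + r → Q.height a ≤ Q.height b := fun a b => hq.mono
  refine (isBasis_upSteps_inter hPQ hq (fun t _ => hPQ t) (fun t _ => le_rfl) (Nat.zero_le c)
    hcn.le (by rw [hp.zero, hq.zero])).isFlat_of_insert_indep ?_
  rintro e ⟨heE, heF⟩
  obtain ⟨z, rfl⟩ : ∃ z, e = z + 1 := ⟨e - 1, by have := heE.1; omega⟩
  have hen : z + 1 ≤ m + r := heE.2
  have hce : c ≤ z := by
    by_contra hcon
    exact heF ⟨by omega, by omega⟩
  have h1 := hq.mono (show c + 1 ≤ z + 1 by omega) hen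
  have h2 := hlt z (by omega) (by omega)
  have h3 := hq.le_succ z (by omega)
  have h4 := hp.succ_le z (by omega)
  have h5 := hq.le_top hen
  -- Follow Q up to c, then stay at height Q c unless P forces a rise, go up at z + 1, and again
  -- stay as low as possible.
  let h : ℕ → ℕ := fun t => if t ≤ z then max (min (Q.height t) (Q.height c)) (P.height t)
    else max (max (Q.height c) (P.height z) + 1) (P.height t)
  have hh : IsHeight (m + r) r h := by
    refine ⟨by simp [h, hp.zero, hq.zero], ?_, fun t ht => ?_, fun t ht => ?_⟩
    · simp only [h]
      rw [if_neg (by omega), hp.top]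
      omega
    all_goals
      have h6 := hp.le_succ t ht
      have h7 := hq.le_succ t ht
      have h8 := hp.succ_le t ht
      have h9 := hq.succ_le t ht
      simp only [h]
      rcases eq_or_ne t z with rfl | h10
      · have := hmq c t hce (by omega)
        split_ifs <;> omega
      · split_ifs <;> omega
  refine (indep_upSteps hPQ hh (fun t ht => ?_) (fun t ht => ?_)).subset ?_
  · simp only [h]
    split_ifs <;> omega
  · have h6 := hPQ t
    have h7 := hmq (z + 1) t
    simp only [h]
    split_ifs <;> omega
  · have h6 := hmq c z hce (by omega)
    rintro t (rfl | ⟨ht, -, htc⟩)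
    · refine mem_upSteps.2 ⟨⟨by omega, hen⟩, ?_⟩
      simp only [h, Nat.add_sub_cancel]
      rw [if_pos le_rfl, if_neg (by omega)]
      omega
    · obtain ⟨ht1, ht2⟩ := mem_upSteps.1 ht
      refine mem_upSteps.2 ⟨ht1, ?_⟩
      have h7 := hPQ (t - 1)
      have h8 := hPQ t
      have h9 := hmq t c htc hcn.le
      simp only [h]
      rw [if_pos (by omega), if_pos (by omega)]
      omega

theorem isFlat_final (hPQ : P.NeverAbove Q)
    (hlt : ∀ t, 0 < t → t < m + r → P.height t < Q.height t) {c : ℕ} (hc : P.NECorner c) :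
    (latticePathMatroid P Q).IsFlat (Set.Ioc c (m + r)) := by
  obtain ⟨hc1, hcn, hc2, -⟩ := P.neCorner_iff.1 hc
  have hp := P.isHeight
  have hq := Q.isHeight
  have hmp : ∀ a b, a ≤ b → b ≤ m + r → P.height a ≤ P.height b := fun a b => hp.mono
  have hmq : ∀ a b, a ≤ b → b ≤ m + r → Q.height a ≤ Q.height b := fun a b => hq.mono
  refine (isBasis_upSteps_inter hPQ hp (fun t _ => le_rfl) (fun t _ => hPQ t) hcn.le le_rfl
    (by rw [hp.top, hq.top])).isFlat_of_insert_indep ?_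
  rintro e ⟨heE, heF⟩
  obtain ⟨z, rfl⟩ : ∃ z, e = z + 1 := ⟨e - 1, by have := heE.1; omega⟩
  have hen : z + 1 ≤ m + r := heE.2
  have hec : z + 1 ≤ c := by
    by_contra hcon
    exact heF ⟨by omega, by omega⟩
  have h1 := hp.mono (show z ≤ c - 1 by omega) (by omega)
  have h2 := hlt (z + 1) (by omega) (by omega)
  have h3 := hp.le_succ z (by omega)
  have h4 := hq.succ_le z (by omega)
  have h5 := hmp (z + 1) c hec hcn.le
  -- The mirror image: arrive at z one below the target min (P c) (Q (z + 1)), go up at z + 1, climb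
  -- to P c as far as Q permits, and agree with P from c on. The subtraction is genuine because P
  -- goes up at c.
  let h : ℕ → ℕ := fun t => if t ≤ z
    then min (min (P.height c) (Q.height (z + 1)) - 1) (Q.height t)
    else min (max (P.height t) (P.height c)) (Q.height t)
  have hh : IsHeight (m + r) r h := by
    refine ⟨by simp [h, hq.zero], ?_, fun t ht => ?_, fun t ht => ?_⟩
    · have := hp.le_top hcn.le
      simp only [h]
      rw [if_neg (by omega), hp.top, hq.top]
      omega
    all_goals
      have h6 := hp.le_succ t ht
      have h7 := hq.le_succ t ht
      have h8 := hp.succ_le t ht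
      have h9 := hq.succ_le t ht
      simp only [h]
      rcases eq_or_ne t z with rfl | h10
      · split_ifs <;> omega
      · split_ifs <;> omega
  refine (indep_upSteps hPQ hh (fun t ht => ?_) (fun t ht => ?_)).subset ?_
  · have h6 := hPQ t
    have h7 := hmp t z
    simp only [h]
    split_ifs <;> omega
  · simp only [h]
    split_ifs <;> omega
  · rintro t (rfl | ⟨ht, htc, -⟩)
    · refine mem_upSteps.2 ⟨⟨by omega, hen⟩, ?_⟩
      simp only [h, Nat.add_sub_cancel]
      rw [if_pos le_rfl, if_neg (by omega)]
      omega
    · obtain ⟨ht1, ht2⟩ := mem_upSteps.1 ht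
      refine mem_upSteps.2 ⟨ht1, ?_⟩
      have h7 := hPQ (t - 1)
      have h8 := hPQ t
      have h9 := hmp c (t - 1) (by omega) (by omega)
      simp only [h]
      rw [if_neg (by omega), if_neg (by omega)]
      omega

theorem isFundamentalFlat_initial (hPQ : P.NeverAbove Q)
    (hconn : IsConnected (latticePathMatroid P Q)) {c : ℕ} (hc : Q.ENCorner c) :
    IsFundamentalFlat (latticePathMatroid P Q) (Set.Ioc 0 c) := by
  have hlt : ∀ t, 0 < t → t < m + r → P.height t < Q.height t :=
    fun t => height_lt_of_isConnected hPQ hconn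
  obtain ⟨hc1, hcn, hc2, hc3⟩ := Q.enCorner_iff.1 hc
  have hp := P.isHeight
  have hq := Q.isHeight
  have hQr := hq.le_top (show c + 1 ≤ m + r by omega)
  refine ⟨hconn, isFlat_initial hPQ hlt hc, ?_, ?_, ?_, ?_⟩
  -- The lowest admissible path through the point of Q at c; truncation keeps it at 0 early on. It
  -- is strictly below Q on (0, c) because step c of Q is East.
  · let p : ℕ → ℕ := fun t => max (P.height t) (min (Q.height c) (Q.height c + t - c))
    refine isConnected_restrict_Ioc hPQ (p := p) (q := Q.height) ⟨?_, ?_, fun t ht => ?_,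
      fun t ht => ?_⟩ hq (fun t _ => le_max_left _ _) (fun t ht => ?_) (fun t _ => le_rfl) hcn.le
      (fun t h1 h2 => ?_) ?_
    · have := hq.le_add (Nat.zero_le c) hcn.le
      simp only [p, hp.zero, hq.zero] at this ⊢
      omega
    · simp only [p, hp.top]
      omega
    · have := hp.le_succ t ht
      simp only [p]
      omega
    · have := hp.succ_le t ht
      simp only [p]
      omega
    · have h1 := hPQ t
      simp only [p]
      rcases le_total t c with h2 | h2
      · have := hq.le_add h2 hcn.le
        omega
      · have := hq.mono h2 ht
        omega
    · have h3 := hlt t h1 (by omega)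
      have h4 := hq.le_add (show t ≤ c - 1 by omega) (by omega)
      simp only [p]
      omega
    · have := hPQ c
      simp only [p, hp.zero, hq.zero]
      omega
  · have hc4 : 2 ≤ c := by
      by_contra hcon
      obtain rfl : c = 1 := by omega
      have := hlt 1 one_pos hcn
      simp only [Nat.sub_self, hq.zero] at hc2
      omega
    rw [← Finset.coe_Ioc, Set.encard_coe_eq_coe_finsetCard, Nat.card_Ioc]
    exact_mod_cast (by omega)
  · rw [eRk_initial hPQ hcn.le, eRank_latticePathMatroid hPQ]
    exact_mod_cast (by omega)
  -- The spanning circuit is the basis of Q with the last element m + r added. The last step of Q is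
  -- East, and as P < Q in the interior, any up-step of Q can be moved to m + r.
  · have hB := isBase_upSteps hPQ hq (fun t _ => hPQ t) (fun t _ => le_rfl)
    have htop : Q.height (m + r - 1) = Q.height (m + r) := by
      have h1 := hlt (m + r - 1) (by omega) (by omega)
      have h2 := hp.le_add (show m + r - 1 ≤ m + r by omega) le_rfl
      have h3 := hq.mono (show m + r - 1 ≤ m + r by omega) le_rfl
      rw [hp.top] at h2
      rw [hq.top] at h3 ⊢
      omega
    have hn : m + r ∉ (upSteps (m + r) Q.height : Set ℕ) := by
      intro h1
      have := (mem_upSteps.1 h1).2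
      omega
    refine ⟨insert (m + r) (upSteps (m + r) Q.height), hB.isCircuit_insert ?_ hn ?_,
      hB.spanning_of_superset (Set.subset_insert _ _) ?_, ?_⟩
    · rw [latticePathMatroid_ground]
      exact ⟨by omega, le_rfl⟩
    · intro x hx
      have hx' := mem_upSteps.1 hx
      have hxn : x ≠ m + r := fun h1 => hn (h1 ▸ hx)
      exact indep_swap_down hPQ hq (fun t _ => hPQ t) (fun t _ => le_rfl) hx (by omega) le_rfl
        htop (fun t h1 h2 => hlt t (by omega) h2)
    · refine Set.insert_subset ?_ hB.subset_ground
      rw [latticePathMatroid_ground]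
      exact ⟨by omega, le_rfl⟩
    · rw [Set.inter_comm, Set.insert_inter_of_notMem (fun h1 => by have := h1.2; omega)]
      exact isBasis_upSteps_inter hPQ hq (fun t _ => hPQ t) (fun t _ => le_rfl) (Nat.zero_le c)
        hcn.le (by rw [hp.zero, hq.zero])

theorem isFundamentalFlat_final (hPQ : P.NeverAbove Q)
    (hconn : IsConnected (latticePathMatroid P Q)) {c : ℕ} (hc : P.NECorner c) :
    IsFundamentalFlat (latticePathMatroid P Q) (Set.Ioc c (m + r)) := by
  have hlt : ∀ t, 0 < t → t < m + r → P.height t < Q.height t :=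
    fun t => height_lt_of_isConnected hPQ hconn
  obtain ⟨hc1, hcn, hc2, hc3⟩ := P.neCorner_iff.1 hc
  have hp := P.isHeight
  have hq := Q.isHeight
  have hPr := hp.le_top hcn.le
  refine ⟨hconn, isFlat_final hPQ hlt hc, ?_, ?_, ?_, ?_⟩
  -- The highest admissible path through the point of P at c. It is strictly above P on (c, m + r)
  -- because step c + 1 of P is East.
  · let q : ℕ → ℕ := fun t => min (Q.height t) (max (P.height c) (P.height c + t - c))
    refine isConnected_restrict_Ioc hPQ (p := P.height) (q := q) hp ⟨?_, ?_, fun t ht => ?_,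
      fun t ht => ?_⟩ (fun t _ => le_rfl) (fun t ht => ?_) (fun t _ => min_le_left _ _) le_rfl
      (fun t h1 h2 => ?_) ?_
    · simp only [q, hq.zero]
      omega
    · have := hp.le_add hcn.le le_rfl
      simp only [q, hq.top, hp.top] at this ⊢
      omega
    · have := hq.le_succ t ht
      simp only [q]
      omega
    · have := hq.succ_le t ht
      simp only [q]
      omega
    · have h1 := hPQ t
      simp only [q]
      rcases le_total t c with h2 | h2
      · have := hp.mono h2 hcn.le
        omega
      · have := hp.le_add h2 ht
        omega
    · have h3 := hlt t (by omega) h2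
      have h4 := hp.le_add (show c + 1 ≤ t by omega) h2.le
      simp only [q]
      omega
    · have := hPQ c
      simp only [q, hp.top, hq.top]
      omega
  · have hc4 : c + 2 ≤ m + r := by
      by_contra hcon
      have hcn' : c + 1 = m + r := by omega
      have h1 := hlt c (by omega) hcn
      have h2 := hq.le_top hcn.le
      rw [hcn', hp.top] at hc3
      omega
    rw [← Finset.coe_Ioc, Set.encard_coe_eq_coe_finsetCard, Nat.card_Ioc]
    exact_mod_cast (by omega)
  · rw [eRk_final hPQ hcn.le, eRank_latticePathMatroid hPQ]
    exact_mod_cast (by omega)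
  -- Dually, the spanning circuit is the basis of P with the element 1 added.
  · have hB := isBase_upSteps hPQ hp (fun t _ => le_rfl) (fun t _ => hPQ t)
    have hbot : P.height (1 - 1) = P.height 1 := by
      have h1 := hlt 1 one_pos (by omega)
      have h2 := hq.le_add (Nat.zero_le 1) (by omega)
      rw [hq.zero] at h2
      simp only [Nat.sub_self, hp.zero]
      omega
    have hn : 1 ∉ (upSteps (m + r) P.height : Set ℕ) := by
      intro h1
      have := (mem_upSteps.1 h1).2
      omega
    refine ⟨insert 1 (upSteps (m + r) P.height), hB.isCircuit_insert ?_ hn ?_,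
      hB.spanning_of_superset (Set.subset_insert _ _) ?_, ?_⟩
    · rw [latticePathMatroid_ground]
      exact ⟨le_rfl, by omega⟩
    · intro x hx
      have hx' := mem_upSteps.1 hx
      have hxn : x ≠ 1 := fun h1 => hn (h1 ▸ hx)
      exact indep_swap_up hPQ hp (fun t _ => le_rfl) (fun t _ => hPQ t) hx le_rfl (by omega)
        hbot (fun t h1 h2 => hlt t (by omega) (by omega))
    · refine Set.insert_subset ?_ hB.subset_ground
      rw [latticePathMatroid_ground]
      exact ⟨le_rfl, by omega⟩
    · rw [Set.inter_comm, Set.insert_inter_of_notMem (fun h1 => by have := h1.1; omega)]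
      exact isBasis_upSteps_inter hPQ hp (fun t _ => le_rfl) (fun t _ => hPQ t) hcn.le le_rfl
        (by rw [hp.top, hq.top])

end

/-! ### Sets as paths, and the uniform case -/

open Finset in
theorem isHeight_card_inter {n : ℕ} {B : Finset ℕ} (hB : B ⊆ Icc 1 n) :
    IsHeight n B.card (fun t => (B ∩ Ioc 0 t).card) ∧
      upSteps n (fun t => (B ∩ Ioc 0 t).card) = B := by
  have hI : ∀ t, Ioc 0 (t + 1) = insert (t + 1) (Ioc 0 t) := by
    intro t
    ext s
    simp only [mem_Ioc, mem_insert]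
    omega
  have hmem : ∀ t, t + 1 ∈ B → (B ∩ Ioc 0 (t + 1)).card = (B ∩ Ioc 0 t).card + 1 := by
    intro t ht
    rw [hI, inter_insert_of_mem ht, card_insert_of_notMem (by simp)]
  have hnot : ∀ t, t + 1 ∉ B → (B ∩ Ioc 0 (t + 1)).card = (B ∩ Ioc 0 t).card := by
    intro t ht
    rw [hI, inter_insert_of_notMem ht]
  refine ⟨⟨by simp, ?_, fun t _ => ?_, fun t _ => ?_⟩, ?_⟩
  · rw [inter_eq_left.2]
    intro t ht
    have := mem_Icc.1 (hB ht)
    exact mem_Ioc.2 ⟨by omega, this.2⟩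
  · by_cases ht : t + 1 ∈ B
    · have := hmem t ht; omega
    · have := hnot t ht; omega
  · by_cases ht : t + 1 ∈ B
    · have := hmem t ht; omega
    · have := hnot t ht; omega
  · ext t
    rw [mem_upSteps]
    constructor
    · rintro ⟨⟨h1, h2⟩, h3⟩
      obtain ⟨t, rfl⟩ : ∃ s, t = s + 1 := ⟨t - 1, by omega⟩
      by_contra ht
      have := hnot t ht
      rw [Nat.add_sub_cancel] at h3
      omega
    · intro ht
      have h1 := mem_Icc.1 (hB ht)
      obtain ⟨t, rfl⟩ : ∃ s, t = s + 1 := ⟨t - 1, by omega⟩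
      have := hmem t ht
      exact ⟨h1, by rw [Nat.add_sub_cancel]; omega⟩

open Finset in
theorem card_le_card_inter_add {n t : ℕ} {B : Finset ℕ} (hB : B ⊆ Icc 1 n) :
    B.card ≤ (B ∩ Ioc 0 t).card + (n - t) := by
  have h1 : B ⊆ (B ∩ Ioc 0 t) ∪ Ioc t n := by
    intro s hs
    have h2 := mem_Icc.1 (hB hs)
    rcases le_or_gt s t with h3 | h3
    · exact mem_union_left _ (mem_inter.2 ⟨hs, mem_Ioc.2 ⟨by omega, h3⟩⟩)
    · exact mem_union_right _ (mem_Ioc.2 ⟨h3, h2.2⟩)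
  have h2 := (card_le_card h1).trans (card_union_le _ _)
  rwa [Nat.card_Ioc] at h2

open Finset in
theorem card_inter_Ioc_le (B : Finset ℕ) (t : ℕ) : (B ∩ Ioc 0 t).card ≤ t := by
  have := card_le_card (inter_subset_right (s₁ := B) (s₂ := Ioc 0 t))
  rwa [Nat.card_Ioc] at this

section

variable {m r : ℕ} {P Q : LatticePath m r}

open Finset in
theorem indep_of_card_inter (hPQ : P.NeverAbove Q) {B : Finset ℕ} (hB : B ⊆ Icc 1 (m + r))
    (hcard : B.card = r) (hP : ∀ t ≤ m + r, P.height t ≤ (B ∩ Ioc 0 t).card)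
    (hQ : ∀ t ≤ m + r, (B ∩ Ioc 0 t).card ≤ Q.height t) :
    (latticePathMatroid P Q).Indep B := by
  obtain ⟨h1, h2⟩ := isHeight_card_inter hB
  rw [hcard] at h1
  rw [← h2]
  exact indep_upSteps hPQ h1 hP hQ

open Finset in
/-- If neither bounding path has a corner, then the lattice path matroid is uniform. -/
theorem isUniform_of_forall_not_corner (hPQ : P.NeverAbove Q) (hP : ∀ t, ¬ P.NECorner t)
    (hQ : ∀ t, ¬ Q.ENCorner t) : IsUniform (latticePathMatroid P Q) := by
  have hp := P.isHeight
  have hq := Q.isHeight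
  -- Without an NE corner, a North step of P is followed only by North steps, so P = E^m N^r.
  -- Dually, `hupp` expresses Q = N^r E^m.
  have hlow : ∀ t ≤ m + r, P.height t ≤ t - m := by
    suffices H : ∀ t ≤ m + r, 0 < P.height t → P.height t + (m + r) = r + t by
      intro t ht
      have h1 := H t ht
      omega
    have hstep : ∀ t, 1 ≤ t → t ≤ m + r → P.height (t - 1) < P.height t →
        P.height t + (m + r) = r + t := by
      intro t ht1 ht h1
      induction ht using Nat.decreasingInduction with
      | self => rw [hp.top]
      | of_succ t ht ih =>
        have h2 := mt P.neCorner_iff.2 (hP t)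
        have h3 := hp.le_succ t ht
        have h4 := hp.succ_le t ht
        have h5 := ih (by omega) (by rw [Nat.add_sub_cancel]; omega)
        omega
    intro t
    induction t with
    | zero => simp [hp.zero]
    | succ t ih =>
      intro ht h1
      by_cases h2 : P.height t < P.height (t + 1)
      · exact hstep (t + 1) (by omega) ht h2
      · have h3 := hp.le_succ t ht
        have h4 := ih (by omega) (by omega)
        have h5 := hp.le_add (show t + 1 ≤ m + r from ht) le_rfl
        rw [hp.top] at h5
        omega
  have hupp : ∀ t ≤ m + r, min t r ≤ Q.height t := by
    suffices H : ∀ t ≤ m + r, Q.height t < r → Q.height t = t by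
      intro t ht
      have h1 := H t ht
      omega
    have hstep : ∀ t < m + r, Q.height t < Q.height (t + 1) → Q.height t = t := by
      intro t
      induction t with
      | zero => simp [hq.zero]
      | succ t ih =>
        intro ht h1
        have h2 := mt Q.enCorner_iff.2 (hQ (t + 1))
        have h3 := hq.le_succ t (by omega)
        have h4 := hq.succ_le t (by omega)
        rw [Nat.add_sub_cancel] at h2
        have h5 := ih (by omega) (by omega)
        omega
    intro t ht
    induction ht using Nat.decreasingInduction with
    | self => simp [hq.top]
    | of_succ t ht ih =>
      intro h1
      by_cases h2 : Q.height t < Q.height (t + 1)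
      · exact hstep t ht h2
      · have h3 := hq.le_succ t ht
        have h5 := ih (by omega)
        have h6 := hq.le_add (Nat.zero_le t) ht.le
        rw [hq.zero] at h6
        omega
  refine ⟨r, fun I hI => ⟨fun h => ?_, fun h => ?_⟩⟩
  · rw [← eRank_latticePathMatroid hPQ]
    exact h.encard_le_eRank
  · lift I to Finset ℕ using Set.Finite.subset (Set.finite_Icc 1 (m + r)) hI
    rw [Set.encard_coe_eq_coe_finsetCard] at h
    have hI' : I ⊆ Icc 1 (m + r) := fun t ht => Finset.mem_Icc.2 (hI ht)
    obtain ⟨B, hIB, hB, hcard⟩ := exists_subsuperset_card_eq hI' (n := r) (by exact_mod_cast h)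
      (by simp)
    refine (indep_of_card_inter hPQ hB hcard (fun t ht => ?_) (fun t ht => ?_)).subset
      (by exact_mod_cast hIB)
    · have h1 := hlow t ht
      have h2 := card_le_card_inter_add (t := t) hB
      omega
    · have h1 := hupp t ht
      have h2 := card_inter_Ioc_le B t
      have h3 := card_le_card (inter_subset_left (s₁ := B) (s₂ := Ioc 0 t))
      omega

/-! ### Lower bound for the connectivity -/

/-- If the bounding paths are at distance at least `w` at every corner, and there is a corner,
then they are everywhere as far apart as the distance to the ends permits, up to `w`. -/
theorem min_le_height_sub {w c : ℕ} (hc0 : c ≤ m + r)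
    (hc : P.height c + w ≤ Q.height c)
    (hP : ∀ t, P.NECorner t → P.height t + w ≤ Q.height t)
    (hQ : ∀ t, Q.ENCorner t → P.height t + w ≤ Q.height t) {t : ℕ} (ht : t ≤ m + r) :
    P.height t + min w (min t (m + r - t)) ≤ Q.height t := by
  have hp := P.isHeight
  have hq := Q.isHeight
  -- Suppose the paths diverge after t at distance less than w. Then t is a corner of neither path,
  -- so they also diverged in the step before, at a still smaller distance. This continues back to
  -- the origin, so the distance at t is t. `hforw` is the same argument towards the end.
  have hback : ∀ t < m + r, P.height t = P.height (t + 1) → Q.height t < Q.height (t + 1) →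
      Q.height t < P.height t + w → Q.height t = P.height t + t := by
    intro t
    induction t with
    | zero => simp [hp.zero, hq.zero]
    | succ t ih =>
      intro ht h1 h2 h3
      have h4 := mt (hP (t + 1)) (by omega)
      have h5 := mt (hQ (t + 1)) (by omega)
      rw [LatticePath.neCorner_iff, Nat.add_sub_cancel] at h4
      rw [LatticePath.enCorner_iff, Nat.add_sub_cancel] at h5
      have h6 := hp.le_succ t (by omega)
      have h7 := hq.le_succ t (by omega)
      have h8 := hq.succ_le t (by omega)
      have h9 := ih (by omega) (by omega) (by omega) (by omega)
      omega
  have hforw : ∀ t, 1 ≤ t → t ≤ m + r → P.height (t - 1) < P.height t →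
      Q.height (t - 1) = Q.height t → Q.height t < P.height t + w →
      Q.height t + t = P.height t + (m + r) := by
    intro t ht1 ht h1 h2 h3
    induction ht using Nat.decreasingInduction with
    | self => rw [hp.top, hq.top]
    | of_succ t ht ih =>
      have h4 := mt (hP t) (by omega)
      have h5 := mt (hQ t) (by omega)
      rw [LatticePath.neCorner_iff] at h4
      rw [LatticePath.enCorner_iff] at h5
      have h6 := hp.le_succ t ht
      have h7 := hq.le_succ t ht
      have h8 := hp.succ_le t ht
      have h9 := ih (by omega) (by rw [Nat.add_sub_cancel]; omega)
        (by rw [Nat.add_sub_cancel]; omega) (by omega)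
      omega
  rcases le_total t c with htc | htc
  · suffices H : P.height t + min w t ≤ Q.height t by omega
    induction htc using Nat.decreasingInduction with
    | self => omega
    | of_succ t htc ih =>
      have h1 := ih (by omega)
      have h2 := hback t (by omega)
      have h3 := hp.le_succ t (by omega)
      have h4 := hp.succ_le t (by omega)
      have h5 := hq.le_succ t (by omega)
      have h6 := hq.succ_le t (by omega)
      omega
  · suffices H : P.height t + min w (m + r - t) ≤ Q.height t by omega
    induction t, htc using Nat.le_induction with
    | base => omega
    | succ t htc ih =>
      have h1 := ih (by omega)
      have h2 := hforw (t + 1) (by omega) ht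
      rw [Nat.add_sub_cancel] at h2
      have h3 := hp.le_succ t (by omega)
      have h4 := hp.succ_le t (by omega)
      have h5 := hq.le_succ t (by omega)
      have h6 := hq.succ_le t (by omega)
      omega

open Finset in
/-- Replacing up-steps of the upper path by as many later steps, at most `w` of them. -/
theorem indep_sdiff_union (hPQ : P.NeverAbove Q) {w : ℕ}
    (hw : ∀ t ≤ m + r, P.height t + min w (min t (m + r - t)) ≤ Q.height t) {A A' : Finset ℕ}
    (hA : A ⊆ upSteps (m + r) Q.height) (hA' : A' ⊆ Icc 1 (m + r))
    (hdisj : Disjoint (upSteps (m + r) Q.height) A') (hcard : A.card = A'.card)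
    (hcw : A.card ≤ w) (hlt : ∀ a ∈ A, ∀ b ∈ A', a < b) :
    (latticePathMatroid P Q).Indep ((upSteps (m + r) Q.height \ A ∪ A' : Finset ℕ) : Set ℕ) := by
  have hq := Q.isHeight
  set S := upSteps (m + r) Q.height with hS
  have hSn : S ⊆ Icc 1 (m + r) := fun t ht => mem_Icc.2 (mem_upSteps.1 ht).1
  have hAle : ∀ U : Finset ℕ, ((S \ A ∪ A') ∩ U).card + (A ∩ U).card =
      (S ∩ U).card + (A' ∩ U).card := by
    intro U
    have h1 : (S \ A ∪ A') ∩ U = (S ∩ U) \ (A ∩ U) ∪ A' ∩ U := by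
      ext t
      simp only [mem_inter, mem_union, mem_sdiff]
      tauto
    have h2 : A ∩ U ⊆ S ∩ U := inter_subset_inter_right hA
    have h3 : Disjoint ((S ∩ U) \ (A ∩ U)) (A' ∩ U) :=
      (hdisj.mono_left (sdiff_subset.trans inter_subset_left)).mono_right inter_subset_left
    have h4 := card_le_card h2
    rw [h1, card_union_of_disjoint h3, card_sdiff_of_subset h2]
    omega
  have hB : S \ A ∪ A' ⊆ Icc 1 (m + r) := union_subset (sdiff_subset.trans hSn) hA'
  have hcount : ∀ t ≤ m + r, (S ∩ Ioc 0 t).card = Q.height t := by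
    intro t ht
    have := hq.card_upSteps_inter (Nat.zero_le t) ht
    rwa [hq.zero] at this
  refine indep_of_card_inter hPQ hB ?_ (fun t ht => ?_) (fun t ht => ?_)
  · have h1 := hAle (Icc 1 (m + r))
    rw [inter_eq_left.2 hB, inter_eq_left.2 (hA.trans hSn), inter_eq_left.2 hSn,
      inter_eq_left.2 hA', show S.card = r from hq.card_upSteps] at h1
    omega
  -- The new path is below Q by |A ∩ (0, t]| - |A' ∩ (0, t]|, which is at most w, at most t, and at
  -- most m + r - t as |A| = |A'|.
  · have h1 := hAle (Ioc 0 t)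
    have h2 := hcount t ht
    have h3 := hw t ht
    have h4 := card_inter_Ioc_le A t
    have h5 := card_le_card_inter_add (t := t) hA'
    have h6 := card_le_card (inter_subset_left (s₁ := A) (s₂ := Ioc 0 t))
    omega
  · have h1 := hAle (Ioc 0 t)
    have h2 := hcount t ht
    -- Once some element of A' is at most t, all of A is.
    suffices H : (A' ∩ Ioc 0 t).card ≤ (A ∩ Ioc 0 t).card by omega
    rcases (A' ∩ Ioc 0 t).eq_empty_or_nonempty with h3 | ⟨b, hb⟩
    · simp [h3]
    · rw [mem_inter, mem_Ioc] at hb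
      have h3 : A ⊆ Ioc 0 t := fun a ha => by
        have h4 := mem_Icc.1 (hSn (hA ha))
        have h5 := hlt a ha b hb.1
        exact mem_Ioc.2 ⟨by omega, by omega⟩
      rw [inter_eq_left.2 h3, hcard]
      exact card_le_card inter_subset_left

open Finset in
/-- The rank function exceeds the modular bound on any two complementary sets. -/
theorem exists_le_eRk_add (hPQ : P.NeverAbove Q) {w : ℕ} (hwn : 2 * w ≤ m + r)
    (hw : ∀ t ≤ m + r, P.height t + min w (min t (m + r - t)) ≤ Q.height t) {X Y : Finset ℕ}
    (hXY : X ∪ Y = Icc 1 (m + r)) (hdisj : Disjoint X Y) :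
    ∃ a b : ℕ, (a : ℕ∞) ≤ (latticePathMatroid P Q).eRk X ∧
      (b : ℕ∞) ≤ (latticePathMatroid P Q).eRk Y ∧ r + min w (min X.card Y.card) ≤ a + b := by
  have hp := P.isHeight
  have hq := Q.isHeight
  have hsum : ∀ U ⊆ Icc 1 (m + r), (X ∩ U).card + (Y ∩ U).card = U.card := by
    intro U hU
    rw [← card_union_of_disjoint ((hdisj.mono_left inter_subset_left).mono_right
      inter_subset_left), ← union_inter_distrib_right, hXY, inter_eq_right.2 hU]
  have hU1 : Icc 1 w ⊆ Icc 1 (m + r) := Icc_subset_Icc le_rfl (by omega)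
  have hU2 : Ioc (m + r - w) (m + r) ⊆ Icc 1 (m + r) := fun t ht => by
    rw [mem_Ioc] at ht
    exact mem_Icc.2 (by omega)
  have hs1 := hsum _ hU1
  have hs2 := hsum _ hU2
  rw [Nat.card_Icc, Nat.add_sub_cancel] at hs1
  rw [Nat.card_Ioc] at hs2
  -- The first w and the last w elements number 2w in all, so one of X, Y contains at most w of
  -- them.
  wlog hle : (X ∩ Icc 1 w).card + (X ∩ Ioc (m + r - w) (m + r)).card ≤ w generalizing X Y
  · obtain ⟨a, b, h1, h2, h3⟩ := this (X := Y) (Y := X) (by rw [union_comm, hXY]) hdisj.symm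
      (fun U hU => by rw [add_comm]; exact hsum U hU) (by omega) (by omega) (by omega)
    exact ⟨b, a, h2, h1, by rw [min_comm X.card, add_comm b]; exact h3⟩
  set S := upSteps (m + r) Q.height with hS
  have hX : X ⊆ Icc 1 (m + r) := hXY ▸ subset_union_left
  have hY : Y ⊆ Icc 1 (m + r) := hXY ▸ subset_union_right
  have hSn : S ⊆ Icc 1 (m + r) := fun t ht => mem_Icc.2 (mem_upSteps.1 ht).1
  have hSc := hsum S hSn
  rw [hS, hq.card_upSteps, ← hS] at hSc
  -- The bound `hw` forces Q to begin with w North steps and, for `hend`, to end with w East steps.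
  have hstart : Icc 1 w ⊆ S := by
    intro t ht
    rw [mem_Icc] at ht
    have h1 := hw t (by omega)
    have h2 := hq.le_add (Nat.zero_le (t - 1)) (by omega)
    rw [hq.zero] at h2
    exact mem_upSteps.2 ⟨by omega, by omega⟩
  have hend : Disjoint S (Ioc (m + r - w) (m + r)) := by
    rw [disjoint_left]
    intro t ht h1
    rw [mem_Ioc] at h1
    have h2 := (mem_upSteps.1 ht).2
    have h3 := hw (t - 1) (by omega)
    have h4 := hp.le_add (show t - 1 ≤ m + r by omega) le_rfl
    have h5 := hq.le_top h1.2
    rw [hp.top] at h4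
    omega
  have hα : (X ∩ Icc 1 w).card ≤ (X ∩ S).card := card_le_card (inter_subset_inter_left hstart)
  have hβ : (X ∩ Ioc (m + r - w) (m + r)).card ≤ (X \ S).card := by
    refine card_le_card fun t ht => ?_
    rw [mem_inter] at ht
    exact mem_sdiff.2 ⟨ht.1, fun h => disjoint_left.1 hend h ht.2⟩
  have hXc := card_inter_add_card_sdiff X S
  -- Trading up-steps A outside Z for later elements A' of Z raises the rank bound |Z ∩ S| for Z by
  -- |A'|.
  have hmain : ∀ (A A' Z : Finset ℕ), A ⊆ S → Disjoint A Z → A' ⊆ Z \ S → Z ⊆ Icc 1 (m + r) →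
      A.card = A'.card → A.card ≤ w → (∀ a ∈ A, ∀ b ∈ A', a < b) →
      (((Z ∩ S).card + A'.card : ℕ) : ℕ∞) ≤ (latticePathMatroid P Q).eRk Z := by
    intro A A' Z hA hAZ hA' hZ hc hcw hlt
    have hA'S : Disjoint S A' := (disjoint_sdiff (s := S) (t := Z)).mono_right hA'
    have hi := indep_sdiff_union hPQ hw hA ((hA'.trans sdiff_subset).trans hZ) hA'S hc hcw hlt
    have hsub : Z ∩ S ∪ A' ⊆ S \ A ∪ A' := by
      refine union_subset_union_left fun t ht => ?_
      rw [mem_inter] at ht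
      exact mem_sdiff.2 ⟨ht.2, fun h => disjoint_left.1 hAZ h ht.1⟩
    have hi' := hi.subset (coe_subset.2 hsub)
    have h1 := hi'.encard_le_eRk_of_subset
      (coe_subset.2 (union_subset inter_subset_left (hA'.trans sdiff_subset)) :
        ((Z ∩ S ∪ A' : Finset ℕ) : Set ℕ) ⊆ (Z : Set ℕ))
    rwa [Set.encard_coe_eq_coe_finsetCard, card_union_of_disjoint
      (hA'S.mono_left inter_subset_right)] at h1
  -- For X, trade initial elements in Y for elements of X \ S; for Y, trade X ∩ S for final elements
  -- in Y. With α, β the numbers of initial and final elements in X, the gains are min(w - α, |X \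
  -- S|) and min(|X ∩ S|, w - β). As α + β ≤ w, α ≤ |X ∩ S| and β ≤ |X \ S|, they add up to at least
  -- min(w, |X|).
  obtain ⟨A₁, hA₁, hA₁c⟩ := exists_subset_card_eq (s := Y ∩ Icc 1 w)
    (n := min (Y ∩ Icc 1 w).card (X \ S).card) (min_le_left _ _)
  obtain ⟨A₁', hA₁', hA₁c'⟩ := exists_subset_card_eq (s := X \ S)
    (n := min (Y ∩ Icc 1 w).card (X \ S).card) (min_le_right _ _)
  obtain ⟨A₂, hA₂, hA₂c⟩ := exists_subset_card_eq (s := X ∩ S)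
    (n := min (X ∩ S).card (Y ∩ Ioc (m + r - w) (m + r)).card) (min_le_left _ _)
  obtain ⟨A₂', hA₂', hA₂c'⟩ := exists_subset_card_eq (s := Y ∩ Ioc (m + r - w) (m + r))
    (n := min (X ∩ S).card (Y ∩ Ioc (m + r - w) (m + r)).card) (min_le_right _ _)
  refine ⟨_, _, hmain A₁ A₁' X ((hA₁.trans inter_subset_right).trans hstart)
    (hdisj.symm.mono_left (hA₁.trans inter_subset_left)) hA₁' hX (by omega) (by omega) ?_,
    hmain A₂ A₂' Y (hA₂.trans inter_subset_right)
    (hdisj.mono_left (hA₂.trans inter_subset_left)) ?_ hY (by omega) (by omega) ?_, ?_⟩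
  · intro a ha b hb
    have h1 := mem_Icc.1 (mem_inter.1 (hA₁ ha)).2
    have h2 := mem_sdiff.1 (hA₁' hb)
    have h3 := mem_Icc.1 (hX h2.1)
    by_contra h4
    exact h2.2 (hstart (mem_Icc.2 ⟨h3.1, by omega⟩))
  · intro t ht
    have h1 := mem_inter.1 (hA₂' ht)
    exact mem_sdiff.2 ⟨h1.1, fun h => disjoint_left.1 hend h h1.2⟩
  · intro a ha b hb
    have h1 := (mem_inter.1 (hA₂ ha)).2
    have h2 := mem_Ioc.1 (mem_inter.1 (hA₂' hb)).2
    by_contra h4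
    have h5 := mem_Icc.1 (hSn h1)
    exact disjoint_left.1 hend h1 (mem_Ioc.2 ⟨by omega, h5.2⟩)
  · omega

theorem lt_of_isSeparation (hPQ : P.NeverAbove Q) {w : ℕ} (hwn : 2 * w ≤ m + r)
    (hw : ∀ t ≤ m + r, P.height t + min w (min t (m + r - t)) ≤ Q.height t) {k : ℕ}
    {X Y : Set ℕ} (hsep : IsSeparation (latticePathMatroid P Q) k X Y) : w < k := by
  obtain ⟨⟨hk, hXY, hdisj, hX, hY⟩, hrk⟩ := hsep
  rw [latticePathMatroid_ground] at hXY
  lift X to Finset ℕ using (Set.finite_Icc 1 (m + r)).subset (hXY ▸ Set.subset_union_left)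
  lift Y to Finset ℕ using (Set.finite_Icc 1 (m + r)).subset (hXY ▸ Set.subset_union_right)
  rw [Set.encard_coe_eq_coe_finsetCard] at hX hY
  obtain ⟨a, b, ha, hb, hab⟩ := exists_le_eRk_add hPQ hwn hw (X := X) (Y := Y)
    (Finset.coe_injective (by rw [Finset.coe_union, hXY, Finset.coe_Icc]))
    (by exact_mod_cast hdisj)
  rw [eRank_latticePathMatroid hPQ] at hrk
  have h1 : ((a + b + 1 : ℕ) : ℕ∞) ≤ ((r + k : ℕ) : ℕ∞) := by
    push_cast
    exact le_trans (by gcongr) hrk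
  have h2 : a + b + 1 ≤ r + k := by exact_mod_cast h1
  have h3 : k ≤ X.card := by exact_mod_cast hX
  have h4 : k ≤ Y.card := by exact_mod_cast hY
  omega

/-! ### Separations from corners -/

theorem isExactSeparation_Ioc (hPQ : P.NeverAbove Q) {c : ℕ} (hc : c ≤ m + r) {k : ℕ}
    (hk : k = Q.height c - P.height c + 1) (hkc : k ≤ c) (hkn : k ≤ m + r - c) :
    IsExactSeparation (latticePathMatroid P Q) k (Set.Ioc 0 c) (Set.Ioc c (m + r)) := by
  have hle := P.isHeight.le_top hc
  have := hPQ c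
  refine ⟨⟨by omega, ?_, Set.Ioc_disjoint_Ioc_of_le le_rfl, ?_, ?_⟩, ?_⟩
  · rw [ground_eq_Ioc, Set.Ioc_union_Ioc_eq_Ioc (Nat.zero_le c) hc]
  · rw [← Finset.coe_Ioc, Set.encard_coe_eq_coe_finsetCard, Nat.card_Ioc]
    exact_mod_cast hkc
  · rw [← Finset.coe_Ioc, Set.encard_coe_eq_coe_finsetCard, Nat.card_Ioc]
    exact_mod_cast hkn
  · rw [eRk_initial hPQ hc, eRk_final hPQ hc, eRank_latticePathMatroid hPQ]
    norm_cast
    omega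

theorem IsExactSeparation.symm {α : Type*} {M : Matroid α} {k : ℕ} {X Y : Set α}
    (h : IsExactSeparation M k X Y) : IsExactSeparation M k Y X := by
  obtain ⟨⟨h1, h2, h3, h4, h5⟩, h6⟩ := h
  exact ⟨⟨h1, by rw [Set.union_comm, h2], h3.symm, h5, h4⟩, by rw [add_comm (M.eRk Y), h6]⟩

theorem IsExactSeparation.isSeparation {α : Type*} {M : Matroid α} {k : ℕ} {X Y : Set α}
    (h : IsExactSeparation M k X Y) : IsSeparation M k X Y :=
  ⟨h.1, h.2.le⟩

theorem IsExactSeparation.compl_eq {α : Type*} {M : Matroid α} {k : ℕ} {X Y : Set α}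
    (h : IsExactSeparation M k X Y) : M.E \ X = Y := by
  obtain ⟨⟨-, h2, h3, -, -⟩, -⟩ := h
  rw [← h2, Set.union_sdiff_cancel_left h3.le_bot]

theorem mem_cornerIncidenceSizes_iff (hPQ : P.NeverAbove Q) {k : ℕ} :
    k ∈ cornerIncidenceSizes P Q ↔
      ∃ c, (P.NECorner c ∨ Q.ENCorner c) ∧ k = Q.height c - P.height c + 1 := by
  have hp := P.isHeight
  have hq := Q.isHeight
  constructor
  · rintro ⟨j, hj | hj, rfl⟩
    · refine ⟨j, Or.inl hj, ?_⟩
      obtain ⟨h1, h2, h3, -⟩ := P.neCorner_iff.1 hj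
      have h4 := hp.succ_le (j - 1) (by omega)
      rw [Nat.sub_add_cancel h1] at h4
      have := hPQ j
      rw [ncard_elementIncidence hPQ h1 h2.le]
      omega
    · refine ⟨j - 1, Or.inr hj, ?_⟩
      obtain ⟨h1, h2, -, h3⟩ := Q.enCorner_iff.1 hj
      have h4 := hq.succ_le (j - 1) h2
      have := hPQ (j - 1)
      rw [Nat.sub_add_cancel (by omega)] at h3 h4
      rw [ncard_elementIncidence hPQ (by omega) (by omega)]
      omega
  · rintro ⟨c, hc | hc, rfl⟩
    · refine ⟨c, Or.inl hc, ?_⟩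
      obtain ⟨h1, h2, h3, -⟩ := P.neCorner_iff.1 hc
      have h4 := hp.succ_le (c - 1) (by omega)
      rw [Nat.sub_add_cancel h1] at h4
      have := hPQ c
      rw [ncard_elementIncidence hPQ h1 h2.le]
      omega
    · refine ⟨c + 1, Or.inr hc, ?_⟩
      obtain ⟨h1, h2, -, h3⟩ := Q.enCorner_iff.1 hc
      have h4 := hq.succ_le c h2
      have := hPQ c
      rw [ncard_elementIncidence hPQ (by omega) (by omega), Nat.add_sub_cancel]
      omega

/-- A corner at `c` splits the ground set into a fundamental flat and its complement. -/
theorem exists_isFundamentalFlat_isExactSeparation (hPQ : P.NeverAbove Q)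
    (hconn : IsConnected (latticePathMatroid P Q)) {c : ℕ} (hc : P.NECorner c ∨ Q.ENCorner c) :
    ∃ F, IsFundamentalFlat (latticePathMatroid P Q) F ∧
      IsExactSeparation (latticePathMatroid P Q) (Q.height c - P.height c + 1) F
        ((latticePathMatroid P Q).E \ F) := by
  have hp := P.isHeight
  have hq := Q.isHeight
  rcases hc with hc | hc
  · obtain ⟨h1, h2, h3, h4⟩ := P.neCorner_iff.1 hc
    have h5 := hp.le_add (show c + 1 ≤ m + r from h2) le_rfl
    have h6 := hq.le_top h2.le
    have h7 := hq.le_add (Nat.zero_le c) h2.le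
    rw [hp.top] at h5
    rw [hq.zero] at h7
    -- Both sides are large enough: step c of P is North, so P c ≥ 1, and step c + 1 is East, so r -
    -- P c < m + r - c.
    have hsep := (isExactSeparation_Ioc hPQ h2.le rfl (by omega) (by omega)).symm
    exact ⟨_, isFundamentalFlat_final hPQ hconn hc, by rw [hsep.compl_eq]; exact hsep⟩
  · obtain ⟨h1, h2, h3, h4⟩ := Q.enCorner_iff.1 hc
    have h5 := hp.le_add h2.le le_rfl
    have h6 := hq.le_top (show c + 1 ≤ m + r from h2)
    have h7 := hq.le_add (Nat.zero_le (c - 1)) (by omega)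
    rw [hp.top] at h5
    rw [hq.zero] at h7
    have hsep := isExactSeparation_Ioc hPQ h2.le rfl (by omega) (by omega)
    exact ⟨_, isFundamentalFlat_initial hPQ hconn hc, by rw [hsep.compl_eq]; exact hsep⟩

end

end LPM

theorem theorem7p4 (m r : ℕ) (P Q : LPM.LatticePath m r) (hPQ : P.NeverAbove Q)
    (hconn : LPM.IsConnected (LPM.latticePathMatroid P Q))
    (hunif : ¬ LPM.IsUniform (LPM.latticePathMatroid P Q)) :
    ∃ k : ℕ, IsLeast (LPM.cornerIncidenceSizes P Q) k ∧
      LPM.tutteConnectivity (LPM.latticePathMatroid P Q) = (k : ℕ∞) ∧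
      ∃ F : Set ℕ, LPM.IsFundamentalFlat (LPM.latticePathMatroid P Q) F ∧
        LPM.IsExactSeparation (LPM.latticePathMatroid P Q) k F
          ((LPM.latticePathMatroid P Q).E \ F) := by
  have hne : (LPM.cornerIncidenceSizes P Q).Nonempty := by
    by_contra hcon
    refine hunif (LPM.isUniform_of_forall_not_corner hPQ (fun t ht => hcon ?_)
      (fun t ht => hcon ?_))
    · exact ⟨_, (LPM.mem_cornerIncidenceSizes_iff hPQ).2 ⟨t, Or.inl ht, rfl⟩⟩
    · exact ⟨_, (LPM.mem_cornerIncidenceSizes_iff hPQ).2 ⟨t, Or.inr ht, rfl⟩⟩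
  obtain ⟨k, hk⟩ : ∃ k, IsLeast (LPM.cornerIncidenceSizes P Q) k :=
    ⟨_, Nat.sInf_mem hne, fun _ h => Nat.sInf_le h⟩
  obtain ⟨c, hc, hkc⟩ := (LPM.mem_cornerIncidenceSizes_iff hPQ).1 hk.1
  obtain ⟨F, hF, hsep⟩ := LPM.exists_isFundamentalFlat_isExactSeparation hPQ hconn hc
  rw [← hkc] at hsep
  refine ⟨k, hk, le_antisymm (iInf₂_le k ⟨_, _, hsep.isSeparation⟩) ?_, F, hF, hsep⟩
  have hmin : ∀ t, P.NECorner t ∨ Q.ENCorner t → P.height t + (k - 1) ≤ Q.height t := by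
    intro t ht
    have h1 := hk.2 ((LPM.mem_cornerIncidenceSizes_iff hPQ).2 ⟨t, ht, rfl⟩)
    have := hPQ t
    omega
  have hcn : c < m + r := by
    rcases hc with hc | hc
    · exact (P.neCorner_iff.1 hc).2.1
    · exact (Q.enCorner_iff.1 hc).2.1
  have h1 := Q.isHeight.le_add (Nat.zero_le c) hcn.le
  have h2 := P.isHeight.le_add hcn.le le_rfl
  have h3 := Q.isHeight.le_top hcn.le
  rw [Q.isHeight.zero] at h1
  rw [P.isHeight.top] at h2
  refine le_iInf₂ fun l ⟨X, Y, hl⟩ => ?_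
  -- The condition 2w ≤ m + r holds since w = Q c - P c is at most c and at most m + r - c.
  have h4 := LPM.lt_of_isSeparation hPQ (w := k - 1) (by omega)
    (fun t => LPM.min_le_height_sub hcn.le (hmin c hc) (fun t ht => hmin t (Or.inl ht))
      (fun t ht => hmin t (Or.inr ht))) hl
  exact_mod_cast (by omega : k ≤ l)
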